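/- All graphs are finite, simple and undirected. For a graph $G$ and $A\subseteq V(G)$, $G[A]$ is the subgraph induced by $A$, $G-A=G[V(G)\setminus A]$, and $c(G)$ is the number of connected components of $G$; components are identified with their vertex sets. A graph is $4K_1$-free if it has no four pairwise non-adjacent vertices. A vertex cut of $G$ is a set $A\subset V(G)$ such that $G-A$ is disconnected; it is minimum if no vertex cut of $G$ has fewer vertices; an articulation point is a vertex $x$ such that $\{x\}$ is a vertex cut. The vertex connectivity of $G$ is $|V(G)|-1$ if $G$ is complete and the size of a minimum vertex cut otherwise; $G$ is 2-connected if its vertex connectivity is at least $2$. A Hamiltonian path is a path containing all vertices of the graph. Theorem 5. Let $G$ be a connected $4K_1$-free graph and let $u$ be a vertex of $G$. The graph $G$ has a Hamiltonian path starting in $u$ if and only if all of the following conditions are satisfied. (a) The graph $G$ has a Hamiltonian path. (b) The vertex $u$ is not an articulation point of $G$. (c) For every articulation point $x\neq u$ of $G$, with $Q_u$ the component of $G-\{x\}$ containing $u$: if $G[Q_u]$ is not 2-connected, then for every articulation point $y\neq u$ of $G[Q_u]$ there exists a vertex $v\in Q_u$ adjacent to $x$ such that $u$ and $v$ are in different components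 of $G[Q_u]-\{y\}$. (d) For every articulation point $x\neq u$ of $G$, with $Q_u$ the component of $G-\{x\}$ containing $u$: if $G[Q_u]$ is 2-connected, then there exists $v\in Q_u$ adjacent to $x$ such that $v\neq u$ and $\{u,v\}$ is not a minimum vertex cut in $G[Q_u]$. (e) There is no vertex $x$ such that $c(G-\{u,x\})\geq 3$. (f) If $G$ is 2-connected, then for all $x\ne y$ such that $\{x,y\}$ is a minimum vertex cut of $G$ with $c(G-\{x,y\})=2$, and every labelling $Q_1,Q_2$ of the two components of $G-\{x,y\}$ such that $Q_1$ is a clique: if all neighbours of $x$ in $Q_2$ are articulation points of $G[Q_2]$, then $u\neq y$. -/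

import Mathlib

namespace HamPath

variable {V : Type*}

/-- The graph `G - A` obtained by deleting a set `A` of vertices. -/
abbrev del (G : SimpleGraph V) (A : Set V) : SimpleGraph ↥(Aᶜ) := G.induce Aᶜ

/-- `G` is `k K₁`-free: the edgeless graph on `k` vertices is not an induced subgraph of `G`. -/
def IsKK1Free (k : ℕ) (G : SimpleGraph V) : Prop :=
  ¬ (⊥ : SimpleGraph (Fin k)).IsIndContained G

/-- The number `c(G)` of connected components of `G`. -/
noncomputable def numComponents (G : SimpleGraph V) : ℕ := Nat.card G.ConnectedComponent

/-- `Q` is (the vertex set of) a connected component of `G - A`. -/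
def IsComponentOfDel (G : SimpleGraph V) (A Q : Set V) : Prop :=
  ∃ C : (del G A).ConnectedComponent, Q = Subtype.val '' C.supp

/-- `u` and `v` lie in different connected components of `G - A`
(in particular, neither of them is in `A`). -/
def InDifferentComponents (G : SimpleGraph V) (A : Set V) (u v : V) : Prop :=
  ∃ (hu : u ∈ Aᶜ) (hv : v ∈ Aᶜ),
    (del G A).connectedComponentMk ⟨u, hu⟩ ≠ (del G A).connectedComponentMk ⟨v, hv⟩

/-- `A` is a vertex cut of `G`: the graph `G - A` is disconnected, that is, it has two vertices
that are not joined by a path. -/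
def IsVertexCut (G : SimpleGraph V) (A : Set V) : Prop := ¬ (del G A).Preconnected

/-- `v` is an articulation point of `G`: a vertex cut of size one. -/
def IsArticulationPoint (G : SimpleGraph V) (v : V) : Prop := IsVertexCut G {v}

/-- A minimum vertex cut of a (finite) graph: a vertex cut of smallest cardinality. -/
def IsMinVertexCut (G : SimpleGraph V) (A : Set V) : Prop :=
  IsVertexCut G A ∧ ∀ B : Set V, IsVertexCut G B → A.ncard ≤ B.ncard

open Classical in
/-- The vertex connectivity of a finite graph: `|V(G)| - 1` if `G` is complete, and otherwise the
cardinality of a minimum vertex cut. -/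
noncomputable def vertexConnectivity (G : SimpleGraph V) : ℕ :=
  if G = ⊤ then Nat.card V - 1
  else sInf {k : ℕ | ∃ A : Set V, IsVertexCut G A ∧ A.ncard = k}

/-- `G` is 2-connected. -/
def IsTwoConnected (G : SimpleGraph V) : Prop := 2 ≤ vertexConnectivity G

/-- `G` has a Hamiltonian path starting in the vertex `u`. -/
def HasHamPathFrom [DecidableEq V] (G : SimpleGraph V) (u : V) : Prop :=
  ∃ (v : V) (p : G.Walk u v), p.IsHamiltonian

/-- `G` has a Hamiltonian path. -/
def HasHamPath [DecidableEq V] (G : SimpleGraph V) : Prop :=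
  ∃ u : V, HasHamPathFrom G u

/-- If `G[Q_u]` is not 2-connected, where `Q_u` is the component containing `u` of `G - x` for an
articulation point `x ≠ u`, then for every articulation point `y ≠ u` of `G[Q_u]` some neighbour
`v ∈ Q_u` of `x` is separated from `u` by `y` in `G[Q_u]`. -/
def CondC (G : SimpleGraph V) (u : V) : Prop :=
  ∀ x : V, x ≠ u → IsArticulationPoint G x →
    ∀ Q : Set V, IsComponentOfDel G {x} Q → ∀ hu : u ∈ Q,
      ¬ IsTwoConnected (G.induce Q) →
        ∀ y : Q, y ≠ ⟨u, hu⟩ → IsArticulationPoint (G.induce Q) y →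
          ∃ v : Q, G.Adj x v ∧ InDifferentComponents (G.induce Q) {y} ⟨u, hu⟩ v

/-- If `G[Q_u]` is 2-connected, where `Q_u` is the component containing `u` of `G - x` for an
articulation point `x ≠ u`, then `x` has a neighbour `v ≠ u` in `Q_u` such that `{u, v}` is not a
minimum vertex cut of `G[Q_u]`. -/
def CondD (G : SimpleGraph V) (u : V) : Prop :=
  ∀ x : V, x ≠ u → IsArticulationPoint G x →
    ∀ Q : Set V, IsComponentOfDel G {x} Q → ∀ hu : u ∈ Q,
      IsTwoConnected (G.induce Q) →
        ∃ v : Q, G.Adj x v ∧ v ≠ ⟨u, hu⟩ ∧ ¬ IsMinVertexCut (G.induce Q) {⟨u, hu⟩, v}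

/-- No vertex `x` satisfies `c(G - {u, x}) ≥ 3`. -/
def CondE (G : SimpleGraph V) (u : V) : Prop :=
  ¬ ∃ x : V, 3 ≤ numComponents (del G {u, x})

/-- If `G` is 2-connected, `{x, y}` is a minimum vertex cut with `c(G - {x, y}) = 2`, the components
of `G - {x, y}` are `Q₁` and `Q₂`, `Q₁` is a clique, and all neighbours of `x` in `Q₂` are
articulation points of `G[Q₂]`, then `u ≠ y`. -/
def CondF (G : SimpleGraph V) (u : V) : Prop :=
  IsTwoConnected G →
    ∀ x y : V, x ≠ y → IsMinVertexCut G {x, y} → numComponents (del G {x, y}) = 2 →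
      ∀ Q₁ Q₂ : Set V, IsComponentOfDel G {x, y} Q₁ → IsComponentOfDel G {x, y} Q₂ → Q₁ ≠ Q₂ →
        G.IsClique Q₁ →
        (∀ w : Q₂, G.Adj x w → IsArticulationPoint (G.induce Q₂) w) →
          u ≠ y

end HamPath

/-!
Let `H` be a component of the complement of a longest path with prescribed end conditions. The
rotations of the path that could be lengthened through `H` are forbidden, so neighbours on the path
of the vertices adjacent to `H`, together with a vertex of `H`, are independent. If the independence
number is at most 2 this gives, in a connected graph, a Hamiltonian path from every vertex that is
not an articulation point, and without articulation points a Hamiltonian path between any two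
vertices that do not form a vertex cut.

Suppose first that `G` has an articulation point `x`, and let `Q` be the component of `G - x`
containing `u`. A vertex outside `Q` shows that `G[Q]` has independence number at most 2; by (c),
(d) and (e) it has a Hamiltonian path from `u` to a neighbour of `x`, which can replace the part in
`Q` of the Hamiltonian path of (a).

Suppose now that `G` has no articulation point, and that a longest path from `u` misses a component
`H`. Independence number at most 3 forces exactly two vertices of the path to be adjacent to `H`,
namely `u` and some `s`, and `H` to be a clique. By (e) and (f), one goes from `u` through the
clique to `s` and then along a Hamiltonian path of the other component of `G - {u, s}`.

Conversely, deleting the vertex or the pair of vertices in question splits a Hamiltonian path from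
`u` into at most two paths, and these have to span the components.
-/

namespace HamPath

variable {V : Type*} {G : SimpleGraph V}

section Components

variable {A Q S X : Set V} {u v z : V}

/-- `X` is a union of connected components of `G - A`. Separation and connectivity statements
about `G - A` are phrased with such sets, which are subsets of `V` rather than of `↥Aᶜ`. -/
structure IsDelClosed (G : SimpleGraph V) (A X : Set V) : Prop where
  notMem : ∀ {v}, v ∈ X → v ∉ A
  mem_of_adj : ∀ {v w}, v ∈ X → G.Adj v w → w ∉ A → w ∈ X

theorem IsDelClosed.mem_of_reachable (hX : IsDelClosed G A X) {a b : ↥Aᶜ}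
    (hab : (del G A).Reachable a b) (ha : (a : V) ∈ X) : (b : V) ∈ X := by
  obtain ⟨p⟩ := hab
  induction p with
  | nil => exact ha
  | @cons _ c _ hadj _ ih => exact ih (hX.mem_of_adj ha hadj c.2)

theorem IsDelClosed.diff (hX : IsDelClosed G A X) (S : Set V) :
    IsDelClosed G (A ∪ S) (X \ S) where
  notMem := fun hv h => h.elim (hX.notMem hv.1) hv.2
  mem_of_adj := fun hv hvw hw =>
    ⟨hX.mem_of_adj hv.1 hvw fun h => hw (.inl h), fun h => hw (.inr h)⟩

theorem IsDelClosed.image_val (hQ : IsDelClosed G A Q) {B X : Set Q}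
    (hX : IsDelClosed (G.induce Q) B X) :
    IsDelClosed G (A ∪ Subtype.val '' B) (Subtype.val '' X) where
  notMem := by
    rintro _ ⟨x, hx, rfl⟩ (h | ⟨y, hy, hyx⟩)
    · exact hQ.notMem x.2 h
    · exact hX.notMem hx (Subtype.ext hyx ▸ hy)
  mem_of_adj := by
    rintro _ w ⟨x, hx, rfl⟩ hxw hw
    have hwQ : w ∈ Q := hQ.mem_of_adj x.2 hxw fun h => hw (.inl h)
    exact ⟨⟨w, hwQ⟩, hX.mem_of_adj hx hxw fun h => hw (.inr ⟨_, h, rfl⟩), rfl⟩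

theorem isDelClosed_supp (C : (del G A).ConnectedComponent) :
    IsDelClosed G A (Subtype.val '' C.supp) where
  notMem := by
    rintro _ ⟨a, -, rfl⟩
    exact a.2
  mem_of_adj := by
    rintro _ w ⟨a, ha, rfl⟩ haw hw
    exact ⟨⟨w, hw⟩, C.mem_supp_of_adj_mem_supp (v := ⟨w, hw⟩) ha haw, rfl⟩

theorem isDelClosed_setOf_reachable (G : SimpleGraph V) (u : V) :
    IsDelClosed G ∅ {v | G.Reachable u v} where
  notMem := fun _ => Set.notMem_empty _
  mem_of_adj := fun hv hvw _ => SimpleGraph.Reachable.trans hv hvw.reachable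

theorem inDifferentComponents_iff : InDifferentComponents G A u v ↔
    u ∉ A ∧ v ∉ A ∧ ∃ X, IsDelClosed G A X ∧ u ∈ X ∧ v ∉ X := by
  constructor
  · rintro ⟨hu, hv, hne⟩
    refine ⟨hu, hv, _, isDelClosed_supp ((del G A).connectedComponentMk ⟨u, hu⟩),
      ⟨⟨u, hu⟩, rfl, rfl⟩, ?_⟩
    rintro ⟨a, ha, rfl⟩
    exact hne ha.symm
  · rintro ⟨hu, hv, X, hX, huX, hvX⟩
    exact ⟨hu, hv, fun h => hvX (hX.mem_of_reachable (SimpleGraph.ConnectedComponent.exact h) huX)⟩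

theorem IsDelClosed.inDifferentComponents (hX : IsDelClosed G A X) (hu : u ∈ X) (hv : v ∉ X)
    (hvA : v ∉ A) : InDifferentComponents G A u v :=
  inDifferentComponents_iff.2 ⟨hX.notMem hu, hvA, X, hX, hu, hv⟩

theorem InDifferentComponents.symm (h : InDifferentComponents G A u v) :
    InDifferentComponents G A v u :=
  have ⟨hu, hv, hne⟩ := h
  ⟨hv, hu, hne.symm⟩

theorem isVertexCut_iff : IsVertexCut G A ↔ ∃ u v, InDifferentComponents G A u v := by
  simp only [IsVertexCut, SimpleGraph.Preconnected, InDifferentComponents, ne_eq,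
    SimpleGraph.ConnectedComponent.eq, Subtype.forall, not_forall]
  tauto

theorem IsDelClosed.isVertexCut (hX : IsDelClosed G A X) (hu : u ∈ X) (hv : v ∉ X)
    (hvA : v ∉ A) : IsVertexCut G A :=
  isVertexCut_iff.2 ⟨u, v, hX.inDifferentComponents hu hv hvA⟩

theorem IsVertexCut.exists_inDifferentComponents (h : IsVertexCut G A) (hu : u ∉ A) :
    ∃ v, InDifferentComponents G A u v := by
  obtain ⟨a, b, hab⟩ := isVertexCut_iff.1 h
  obtain ⟨-, hb, X, hX, haX, hbX⟩ := inDifferentComponents_iff.1 hab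
  by_cases huX : u ∈ X
  · exact ⟨b, hX.inDifferentComponents huX hbX hb⟩
  · exact ⟨a, (hX.inDifferentComponents haX huX hu).symm⟩

theorem isVertexCut_empty_iff : IsVertexCut G ∅ ↔ ¬ G.Preconnected := by
  rw [IsVertexCut, del, Set.compl_empty, (SimpleGraph.induceUnivIso G).preconnected_iff]

theorem three_le_numComponents_iff [Finite V] :
    3 ≤ numComponents (del G A) ↔ ∃ a b c, InDifferentComponents G A a b ∧
      InDifferentComponents G A a c ∧ InDifferentComponents G A b c := by
  have := Fintype.ofFinite (del G A).ConnectedComponent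
  rw [numComponents, Nat.card_eq_fintype_card, Nat.succ_le_iff, Fintype.two_lt_card_iff]
  constructor
  · rintro ⟨⟨a⟩, ⟨b⟩, ⟨c⟩, hab, hac, hbc⟩
    exact ⟨a, b, c, ⟨a.2, b.2, hab⟩, ⟨a.2, c.2, hac⟩, ⟨b.2, c.2, hbc⟩⟩
  · rintro ⟨a, b, c, ⟨ha, hb, hab⟩, ⟨_, hc, hac⟩, ⟨_, _, hbc⟩⟩
    exact ⟨_, _, _, hab, hac, hbc⟩

theorem IsDelClosed.three_le_numComponents [Finite V] (hQ : IsDelClosed G A Q) {B : Set Q}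
    (hB : IsVertexCut (G.induce Q) B) (hvQ : v ∉ Q) (hvA : v ∉ A) :
    3 ≤ numComponents (del G (A ∪ Subtype.val '' B)) := by
  obtain ⟨a, b, hab⟩ := isVertexCut_iff.1 hB
  obtain ⟨ha, hb, X, hX, haX, hbX⟩ := inDifferentComponents_iff.1 hab
  have hval : ∀ z : Q, (z : V) ∈ A ∪ Subtype.val '' B ↔ z ∈ B := fun z => by
    simp [hQ.notMem z.2]
  have hv : v ∉ A ∪ Subtype.val '' B := by simp [hvA, hvQ]
  have hcl : IsDelClosed G (A ∪ Subtype.val '' B) (Q \ Subtype.val '' B) := hQ.diff _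
  refine three_le_numComponents_iff.2 ⟨a, b, v, (hQ.image_val hX).inDifferentComponents
    ⟨a, haX, rfl⟩ ?_ ((hval b).not.2 hb), hcl.inDifferentComponents ⟨a.2, ?_⟩ (fun h => hvQ h.1) hv,
    hcl.inDifferentComponents ⟨b.2, ?_⟩ (fun h => hvQ h.1) hv⟩
  all_goals simpa

theorem IsDelClosed.mem_or_mem_of_not_three_le [Finite V] {Q₁ Q₂ : Set V}
    (hQ₁ : IsDelClosed G A Q₁) (hQ₂ : IsDelClosed G A Q₂) (hne₁ : Q₁.Nonempty)
    (hne₂ : Q₂.Nonempty) (hdisj : Disjoint Q₁ Q₂) (hnum : ¬ 3 ≤ numComponents (del G A))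
    (hz : z ∉ A) : z ∈ Q₁ ∨ z ∈ Q₂ := by
  by_contra! hcon
  obtain ⟨a, ha⟩ := hne₁
  obtain ⟨b, hb⟩ := hne₂
  exact hnum (three_le_numComponents_iff.2 ⟨a, b, z,
    hQ₁.inDifferentComponents ha (hdisj.notMem_of_mem_right hb) (hQ₂.notMem hb),
    hQ₁.inDifferentComponents ha hcon.1 hz, hQ₂.inDifferentComponents hb hcon.2 hz⟩)

theorem IsVertexCut.two_le_numComponents [Finite V] (h : IsVertexCut G A) :
    2 ≤ numComponents (del G A) := by
  have := Fintype.ofFinite (del G A).ConnectedComponent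
  obtain ⟨a, b, ha, hb, hab⟩ := isVertexCut_iff.1 h
  rw [numComponents, Nat.card_eq_fintype_card, Nat.succ_le_iff, Fintype.one_lt_card_iff]
  exact ⟨_, _, hab⟩

theorem exists_isComponentOfDel (hu : u ∉ A) : ∃ Q, IsComponentOfDel G A Q ∧ u ∈ Q :=
  ⟨_, ⟨(del G A).connectedComponentMk ⟨u, hu⟩, rfl⟩, ⟨u, hu⟩, rfl, rfl⟩

theorem IsComponentOfDel.isDelClosed (hQ : IsComponentOfDel G A Q) : IsDelClosed G A Q := by
  obtain ⟨C, rfl⟩ := hQ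
  exact isDelClosed_supp C

theorem IsComponentOfDel.nonempty (hQ : IsComponentOfDel G A Q) : Q.Nonempty := by
  obtain ⟨C, rfl⟩ := hQ
  exact C.nonempty_supp.image _

theorem IsComponentOfDel.subset (hQ : IsComponentOfDel G A Q) (hX : IsDelClosed G A X)
    (huQ : u ∈ Q) (huX : u ∈ X) : Q ⊆ X := by
  obtain ⟨C, rfl⟩ := hQ
  obtain ⟨a, ha, rfl⟩ := huQ
  rintro _ ⟨b, hb, rfl⟩
  exact hX.mem_of_reachable (SimpleGraph.ConnectedComponent.exact (ha.trans hb.symm)) huX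

theorem IsVertexCut.exists_notMem_component (hA : IsVertexCut G A) (hQ : IsComponentOfDel G A Q) :
    ∃ v, v ∉ A ∧ v ∉ Q := by
  obtain ⟨u, hu⟩ := hQ.nonempty
  obtain ⟨v, hv⟩ := hA.exists_inDifferentComponents (hQ.isDelClosed.notMem hu)
  obtain ⟨-, hvA, X, hX, huX, hvX⟩ := inDifferentComponents_iff.1 hv
  exact ⟨v, hvA, fun hvQ => hvX (hQ.subset hX hu huX hvQ)⟩

theorem IsComponentOfDel.preconnected (hQ : IsComponentOfDel G A Q) :
    (G.induce Q).Preconnected := by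
  intro u v
  have hX := hQ.isDelClosed.image_val (isDelClosed_setOf_reachable (G.induce Q) u)
  rw [Set.image_empty, Set.union_empty] at hX
  obtain ⟨w, hw, hwv⟩ := hQ.subset hX u.2 ⟨u, .refl u, rfl⟩ v.2
  exact Subtype.ext hwv ▸ hw

/-- The vertex `z` has a neighbour in `H`. -/
def Touches (G : SimpleGraph V) (H : Set V) (z : V) : Prop := ∃ k ∈ H, G.Adj z k

-- Otherwise `X` would be a union of components of `G - S`, separating `u` from `v`.
theorem IsDelClosed.exists_touches (hX : IsDelClosed G A X) (hS : ¬ IsVertexCut G S)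
    (hu : u ∈ X) (hXS : Disjoint X S) (hvX : v ∉ X) (hvS : v ∉ S) :
    ∃ z ∈ A, z ∉ S ∧ Touches G X z := by
  by_contra! hcon
  have hXcl : IsDelClosed G S X :=
    { notMem := fun hx hxS => hXS.notMem_of_mem_left hx hxS
      mem_of_adj := fun {x w} hx hxw hw => by_contra fun hwX =>
        hcon w (by_contra fun hwA => hwX (hX.mem_of_adj hx hxw hwA)) hw ⟨x, hx, hxw.symm⟩ }
  exact hS (hXcl.isVertexCut hu hvX hvS)

theorem IsComponentOfDel.exists_touches_ne (hQ : IsComponentOfDel G A Q)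
    (hu : ¬ IsArticulationPoint G u) (huA : u ∈ A) (hvA : v ∈ A) (hvu : v ≠ u) :
    ∃ z ∈ A, z ≠ u ∧ Touches G Q z := by
  obtain ⟨w, hw⟩ := hQ.nonempty
  exact hQ.isDelClosed.exists_touches hu hw
    (Set.disjoint_singleton_right.2 fun huQ => hQ.isDelClosed.notMem huQ huA)
    (fun hvQ => hQ.isDelClosed.notMem hvQ hvA) hvu

end Components

section PathLists

variable {A Q X : Set V} {a b u v : V} {l l₁ l₂ : List V}

/-- The list `l` consists of the successive vertices of a path of `G`; it may be empty. -/
structure IsPathList (G : SimpleGraph V) (l : List V) : Prop where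
  isChain : l.IsChain G.Adj
  nodup : l.Nodup

theorem isChain_adj_reverse : l.reverse.IsChain G.Adj ↔ l.IsChain G.Adj := by
  simp only [List.isChain_reverse, G.adj_comm]

theorem IsPathList.reverse (h : IsPathList G l) : IsPathList G l.reverse :=
  ⟨isChain_adj_reverse.2 h.isChain, List.nodup_reverse.2 h.nodup⟩

theorem isPathList_cons :
    IsPathList G (u :: l) ↔ (∀ v ∈ l.head?, G.Adj u v) ∧ u ∉ l ∧ IsPathList G l := by
  refine ⟨fun ⟨hc, hn⟩ => ?_, fun ⟨hadj, hu, hl⟩ =>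
    ⟨List.isChain_cons.2 ⟨hadj, hl.isChain⟩, List.nodup_cons.2 ⟨hu, hl.nodup⟩⟩⟩
  rw [List.isChain_cons] at hc
  rw [List.nodup_cons] at hn
  exact ⟨hc.1, hn.1, hc.2, hn.2⟩

theorem isPathList_append : IsPathList G (l₁ ++ l₂) ↔ IsPathList G l₁ ∧ IsPathList G l₂ ∧
    (∀ a ∈ l₁.getLast?, ∀ b ∈ l₂.head?, G.Adj a b) ∧ l₁.Disjoint l₂ := by
  refine ⟨fun ⟨hc, hn⟩ => ?_, fun ⟨h₁, h₂, hadj, hd⟩ =>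
    ⟨List.isChain_append.2 ⟨h₁.isChain, h₂.isChain, hadj⟩,
      List.nodup_append'.2 ⟨h₁.nodup, h₂.nodup, hd⟩⟩⟩
  rw [List.isChain_append] at hc
  rw [List.nodup_append'] at hn
  exact ⟨⟨hc.1, hn.1⟩, ⟨hc.2.1, hn.2.1⟩, hc.2.2, hn.2.2⟩

theorem IsPathList.map_val {l : List Q} (h : IsPathList (G.induce Q) l) :
    IsPathList G (l.map Subtype.val) :=
  ⟨(List.isChain_map _).2 h.isChain, h.nodup.map Subtype.val_injective⟩

theorem IsPathList.attachWith (h : IsPathList G l) (hQ : ∀ v ∈ l, v ∈ Q) :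
    IsPathList (G.induce Q) (l.attachWith (· ∈ Q) hQ) := by
  have hval : (l.attachWith (· ∈ Q) hQ).map Subtype.val = l := List.attachWith_map_subtype_val hQ
  refine ⟨?_, List.Nodup.of_map Subtype.val (hval.symm ▸ h.nodup)⟩
  have hchain := h.isChain
  rw [← hval, List.isChain_map] at hchain
  exact hchain

theorem exists_isPathList_of_preconnected (h : G.Preconnected) (a b : V) :
    ∃ l, IsPathList G l ∧ l.head? = some a ∧ l.getLast? = some b := by
  obtain ⟨p, hp⟩ := (h a b).exists_isPath
  refine ⟨p.support, ⟨p.isChain_adj_support, hp.support_nodup⟩, ?_, ?_⟩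
  · rw [List.head?_eq_some_head p.support_ne_nil, p.head_support]
  · rw [List.getLast?_eq_some_getLast p.support_ne_nil, p.getLast_support]

theorem IsComponentOfDel.exists_isPathList (hQ : IsComponentOfDel G A Q) (ha : a ∈ Q)
    (hb : b ∈ Q) :
    ∃ l, IsPathList G l ∧ l.head? = some a ∧ l.getLast? = some b ∧ ∀ v ∈ l, v ∈ Q := by
  obtain ⟨l, hl, hla, hlb⟩ := exists_isPathList_of_preconnected hQ.preconnected ⟨a, ha⟩ ⟨b, hb⟩
  refine ⟨l.map Subtype.val, hl.map_val, ?_, ?_, ?_⟩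
  · rw [List.head?_map, hla, Option.map_some]
  · rw [List.getLast?_map, hlb, Option.map_some]
  · simp only [List.mem_map]
    rintro _ ⟨x, -, rfl⟩
    exact x.2

theorem IsDelClosed.mem_of_isChain (hX : IsDelClosed G A X) (hl : l.IsChain G.Adj)
    (hA : ∀ v ∈ l, v ∉ A) (hu : u ∈ l) (huX : u ∈ X) (hv : v ∈ l) : v ∈ X := by
  have hiff : l.IsChain fun a b => a ∈ X ↔ b ∈ X := hl.imp_of_mem_imp fun a b ha hb hab =>
    ⟨fun h => hX.mem_of_adj h hab (hA b hb), fun h => hX.mem_of_adj h hab.symm (hA a ha)⟩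
  have : Trans (fun a b : V => a ∈ X ↔ b ∈ X) (fun a b => a ∈ X ↔ b ∈ X)
    (fun a b => a ∈ X ↔ b ∈ X) := ⟨Iff.trans⟩
  have : Std.Symm fun a b : V => a ∈ X ↔ b ∈ X := ⟨fun _ _ => Iff.symm⟩
  exact (hiff.pairwise.forall_of_forall (R := fun a b => a ∈ X ↔ b ∈ X)
    (fun _ _ => Iff.rfl) hu hv).1 huX

theorem not_inDifferentComponents_of_isChain (hl : l.IsChain G.Adj) (hA : ∀ v ∈ l, v ∉ A)
    (hu : u ∈ l) (hv : v ∈ l) : ¬ InDifferentComponents G A u v := by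
  intro h
  obtain ⟨-, -, X, hX, huX, hvX⟩ := inDifferentComponents_iff.1 h
  exact hvX (hX.mem_of_isChain hl hA hu huX hv)

theorem not_isVertexCut_of_isChain (hl : l.IsChain G.Adj) (h : ∀ v, v ∈ l ↔ v ∉ A) :
    ¬ IsVertexCut G A := by
  intro hA
  obtain ⟨u, v, huv⟩ := isVertexCut_iff.1 hA
  exact not_inDifferentComponents_of_isChain hl (fun v => (h v).1) ((h u).2 huv.1)
    ((h v).2 huv.2.1) huv

theorem not_three_le_numComponents_of_isChain [Finite V] (h₁ : l₁.IsChain G.Adj)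
    (h₂ : l₂.IsChain G.Adj) (h : ∀ v, v ∈ l₁ ∨ v ∈ l₂ ↔ v ∉ A) :
    ¬ 3 ≤ numComponents (del G A) := by
  rw [three_le_numComponents_iff]
  rintro ⟨a, b, c, hab, hac, hbc⟩
  have hsep : ∀ {x y}, InDifferentComponents G A x y →
      ¬ (x ∈ l₁ ∧ y ∈ l₁) ∧ ¬ (x ∈ l₂ ∧ y ∈ l₂) := fun hxy =>
    ⟨fun hl => not_inDifferentComponents_of_isChain h₁ (fun v hv => (h v).1 (.inl hv)) hl.1 hl.2
      hxy, fun hl => not_inDifferentComponents_of_isChain h₂ (fun v hv => (h v).1 (.inr hv)) hl.1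
      hl.2 hxy⟩
  have ha := (h a).2 hab.1
  have hb := (h b).2 hbc.1
  have hc := (h c).2 hbc.2.1
  have := hsep hab
  have := hsep hac
  have := hsep hbc
  tauto

theorem IsComponentOfDel.mem_iff_mem_chain (hQ : IsComponentOfDel G A Q) (hA : IsVertexCut G A)
    (h₁ : l₁.IsChain G.Adj) (h₂ : l₂.IsChain G.Adj) (h : ∀ v, v ∈ l₁ ∨ v ∈ l₂ ↔ v ∉ A)
    (hu : u ∈ l₁) (huQ : u ∈ Q) (v : V) : v ∈ Q ↔ v ∈ l₁ := by
  have hmem₁ : ∀ w ∈ l₁, w ∉ A := fun w hw => (h w).1 (.inl hw)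
  have hmem₂ : ∀ w ∈ l₂, w ∉ A := fun w hw => (h w).1 (.inr hw)
  have hsub : ∀ w ∈ l₁, w ∈ Q := fun w hw =>
    hQ.isDelClosed.mem_of_isChain h₁ hmem₁ hu huQ hw
  refine ⟨fun hv => by_contra fun hvl => ?_, hsub v⟩
  have hv₂ : v ∈ l₂ := ((h v).2 (hQ.isDelClosed.notMem hv)).resolve_left hvl
  obtain ⟨w, hwA, hwQ⟩ := hA.exists_notMem_component hQ
  exact hwQ <| ((h w).2 hwA).elim (hsub w) fun hw₂ =>
    hQ.isDelClosed.mem_of_isChain h₂ hmem₂ hv₂ hv hw₂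

/-- `l` consists of the successive vertices of a Hamiltonian path of `G` from `u` to `v`. -/
structure IsHamPathList (G : SimpleGraph V) (u v : V) (l : List V) : Prop where
  isPathList : IsPathList G l
  head? : l.head? = some u
  getLast? : l.getLast? = some v
  mem : ∀ w, w ∈ l

theorem IsHamPathList.reverse (h : IsHamPathList G u v l) : IsHamPathList G v u l.reverse where
  isPathList := h.isPathList.reverse
  head? := by rw [List.head?_reverse, h.getLast?]
  getLast? := by rw [List.getLast?_reverse, h.head?]
  mem w := List.mem_reverse.2 (h.mem w)

theorem IsHamPathList.exists_eq_cons (h : IsHamPathList G u v l) : ∃ l', l = u :: l' :=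
  ⟨_, (List.cons_head?_tail h.head?).symm⟩

theorem IsHamPathList.not_isArticulationPoint (h : IsHamPathList G u v l) :
    ¬ IsArticulationPoint G u := by
  obtain ⟨l, rfl⟩ := h.exists_eq_cons
  obtain ⟨-, hul, hl⟩ := isPathList_cons.1 h.isPathList
  refine not_isVertexCut_of_isChain hl.isChain fun w => ?_
  have := h.mem w
  grind

theorem IsHamPathList.mem_map_val {u v : Q} {l : List Q} (h : IsHamPathList (G.induce Q) u v l)
    {w : V} : w ∈ l.map Subtype.val ↔ w ∈ Q := by
  simp only [List.mem_map, h.mem, true_and, Subtype.exists, exists_prop, exists_eq_right]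

theorem hasHamPathFrom_iff [DecidableEq V] :
    HasHamPathFrom G u ↔ ∃ v l, IsHamPathList G u v l := by
  constructor
  · rintro ⟨v, p, hp⟩
    refine ⟨v, p.support, ⟨p.isChain_adj_support, hp.isPath.support_nodup⟩, ?_, ?_,
      hp.mem_support⟩
    · rw [List.head?_eq_some_head p.support_ne_nil, p.head_support]
    · rw [List.getLast?_eq_some_getLast p.support_ne_nil, p.getLast_support]
  · rintro ⟨v, l, h⟩
    obtain ⟨l, rfl⟩ := h.exists_eq_cons
    have hchain := h.isPathList.isChain
    have hsupport := SimpleGraph.Walk.support_ofSupport (List.cons_ne_nil u l) hchain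
    exact ⟨_, SimpleGraph.Walk.ofSupport (u :: l) (List.cons_ne_nil u l) hchain, fun w =>
      (congrArg (List.count w) hsupport).trans
        (List.count_eq_one_of_mem h.isPathList.nodup (h.mem w))⟩

end PathLists

section TwoConnected

variable {a b : V}

theorem not_isVertexCut_top (A : Set V) : ¬ IsVertexCut (⊤ : SimpleGraph V) A := by
  intro h
  refine h fun a b => ?_
  obtain rfl | hab := eq_or_ne a b
  · rfl
  · exact SimpleGraph.Adj.reachable (fun h => hab (Subtype.ext h))

theorem isVertexCut_compl_pair (hab : a ≠ b) (hadj : ¬ G.Adj a b) : IsVertexCut G {a, b}ᶜ := by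
  have hclosed : IsDelClosed G {a, b}ᶜ {a} := by
    refine ⟨by simp, ?_⟩
    rintro _ w rfl haw hw
    obtain rfl | rfl := not_not.1 hw
    · rfl
    · exact absurd haw hadj
  exact hclosed.isVertexCut rfl hab.symm (by simp)

theorem forall_isVertexCut_two_le_ncard_iff [Finite V] :
    (∀ A, IsVertexCut G A → 2 ≤ A.ncard) ↔
      G.Preconnected ∧ ∀ v, ¬ IsArticulationPoint G v := by
  constructor
  · refine fun h => ⟨by_contra fun hG => ?_, fun v hv => ?_⟩
    · simpa using h ∅ (isVertexCut_empty_iff.2 hG)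
    · simpa using h {v} hv
  · rintro ⟨hG, hart⟩ A hA
    by_contra! hlt
    obtain h0 | h1 : A.ncard = 0 ∨ A.ncard = 1 := by omega
    · rw [Set.ncard_eq_zero] at h0
      exact isVertexCut_empty_iff.1 (h0 ▸ hA) hG
    · obtain ⟨v, rfl⟩ := Set.ncard_eq_one.1 h1
      exact hart v hA

theorem isTwoConnected_iff [Finite V] :
    IsTwoConnected G ↔ G.Preconnected ∧ 3 ≤ Nat.card V ∧ ∀ v, ¬ IsArticulationPoint G v := by
  classical
  rw [IsTwoConnected, vertexConnectivity]
  split_ifs with htop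
  · subst htop
    have hart (v : V) : ¬ IsArticulationPoint (⊤ : SimpleGraph V) v := not_isVertexCut_top _
    simp only [SimpleGraph.preconnected_top, hart, not_false_eq_true, implies_true]
    grind
  obtain ⟨a, b, hab, hadj⟩ := SimpleGraph.ne_top_iff_exists_not_adj.1 htop
  have hcut := isVertexCut_compl_pair hab hadj
  have hle : 2 ≤ sInf {k | ∃ A, IsVertexCut G A ∧ A.ncard = k} ↔
      ∀ A, IsVertexCut G A → 2 ≤ A.ncard := by
    have hne : {k | ∃ A, IsVertexCut G A ∧ A.ncard = k}.Nonempty := ⟨_, _, hcut, rfl⟩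
    rw [le_csInf_iff (OrderBot.bddBelow _) hne]
    refine ⟨fun h A hA => h _ ⟨A, hA, rfl⟩, ?_⟩
    rintro h _ ⟨A, hA, rfl⟩
    exact h A hA
  rw [hle]
  refine ⟨fun h => ?_, fun h => forall_isVertexCut_two_le_ncard_iff.2 ⟨h.1, h.2.2⟩⟩
  obtain ⟨hG, hart⟩ := forall_isVertexCut_two_le_ncard_iff.1 h
  refine ⟨hG, ?_, hart⟩
  have h2 := Set.ncard_add_ncard_compl {a, b}
  rw [Set.ncard_pair hab] at h2
  have := h _ hcut
  omega

theorem isTwoConnected_of_isVertexCut_pair [Finite V] (hc : G.Preconnected)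
    (hart : ∀ v, ¬ IsArticulationPoint G v) (hab : a ≠ b) (hcut : IsVertexCut G {a, b}) :
    IsTwoConnected G := by
  obtain ⟨v, -, hv, -⟩ := isVertexCut_iff.1 hcut
  simp only [Set.mem_compl_iff, Set.mem_insert_iff, Set.mem_singleton_iff, not_or] at hv
  have := Fintype.ofFinite V
  refine isTwoConnected_iff.2 ⟨hc, ?_, hart⟩
  rw [Nat.card_eq_fintype_card, Nat.succ_le_iff, Fintype.two_lt_card_iff]
  exact ⟨a, b, v, hab, Ne.symm hv.1, Ne.symm hv.2⟩

theorem IsTwoConnected.isMinVertexCut_pair [Finite V] (h : IsTwoConnected G)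
    (hcut : IsVertexCut G {a, b}) : IsMinVertexCut G {a, b} := by
  obtain ⟨hG, -, hart⟩ := isTwoConnected_iff.1 h
  refine ⟨hcut, fun B hB => (Set.ncard_insert_le a {b}).trans ?_⟩
  rw [Set.ncard_singleton]
  exact forall_isVertexCut_two_le_ncard_iff.2 ⟨hG, hart⟩ B hB

end TwoConnected

section Independence

variable {k : ℕ} {Q : Set V} {l : List V} {m : V}

theorem isKK1Free_iff :
    IsKK1Free k G ↔ ∀ f : Fin k → V, f.Injective → ∃ i j, G.Adj (f i) (f j) := by
  refine ⟨fun h f hf => ?_, fun h ⟨f⟩ => ?_⟩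
  · by_contra! hcon
    exact h ⟨⟨⟨f, hf⟩, fun {i j} => by simpa using hcon i j⟩⟩
  · obtain ⟨i, j, hij⟩ := h f f.injective
    exact (f.map_adj_iff.1 hij).elim

theorem IsKK1Free.not_pairwise_not_adj (hG : IsKK1Free k G) (hl : l.Nodup) (hk : l.length = k) :
    ¬ l.Pairwise (fun a b => ¬ G.Adj a b) := by
  subst hk
  obtain ⟨i, j, hij⟩ := isKK1Free_iff.1 hG l.get hl.injective_get
  intro h
  rw [List.pairwise_iff_get] at h
  obtain hlt | rfl | hlt := lt_trichotomy i j
  · exact h i j hlt hij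
  · exact G.irrefl hij
  · exact h j i hlt hij.symm

theorem IsKK1Free.induce_of_not_touches (hG : IsKK1Free (k + 1) G) (hmQ : m ∉ Q)
    (hm : ¬ Touches G Q m) : IsKK1Free k (G.induce Q) := by
  refine isKK1Free_iff.2 fun f hf => ?_
  obtain ⟨i, j, hij⟩ := isKK1Free_iff.1 hG (Fin.cons m fun i => (f i : V)) <|
    Fin.cons_injective_iff.2 ⟨fun ⟨i, hi⟩ => hmQ (hi ▸ (f i).2), Subtype.val_injective.comp hf⟩
  cases i using Fin.cases <;> cases j using Fin.cases
  · exact (G.irrefl hij).elim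
  · exact (hm ⟨_, (f _).2, hij⟩).elim
  · exact (hm ⟨_, (f _).2, hij.symm⟩).elim
  · exact ⟨_, _, hij⟩

end Independence

section LongestPaths

variable {p : List V → Prop} {P L R U A B : List V} {H : Set V} {a b c s s₁ s₂ t u : V}

/-- `P` is a longest path of `G` among those satisfying `p`. -/
structure IsLongest (G : SimpleGraph V) (p : List V → Prop) (P : List V) : Prop where
  isPathList : IsPathList G P
  prop : p P
  length_le : ∀ {l}, IsPathList G l → p l → l.length ≤ P.length

theorem exists_isLongest [Finite V] {l : List V} (hl : IsPathList G l) (hp : p l) :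
    ∃ P, IsLongest G p P := by
  have := Fintype.ofFinite V
  let lengths : Set ℕ := {n | ∃ l, IsPathList G l ∧ p l ∧ l.length = n}
  have hbdd : BddAbove lengths := by
    refine ⟨Fintype.card V, ?_⟩
    rintro _ ⟨l, hl, -, rfl⟩
    exact hl.nodup.length_le_card
  obtain ⟨P, hP, hpP, hlen⟩ := Nat.sSup_mem (s := lengths) ⟨_, l, hl, hp, rfl⟩ hbdd
  exact ⟨P, hP, hpP, fun {l'} hl' hp' => hlen ▸ le_csSup hbdd ⟨l', hl', hp', rfl⟩⟩

theorem IsLongest.reverse (hP : IsLongest G p P) :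
    IsLongest G (fun l => p l.reverse) P.reverse where
  isPathList := hP.isPathList.reverse
  prop := by simpa only [List.reverse_reverse] using hP.prop
  length_le hl hp := by simpa only [List.length_reverse] using hP.length_le hl.reverse hp

-- A path inside `H` inserted between `L` and `R` would lengthen `P`.
theorem IsLongest.false_of_perm (hP : IsLongest G p P) (hH : IsComponentOfDel G {x | x ∈ P} H)
    (hperm : (L ++ R).Perm P) (hL : L.IsChain G.Adj) (hR : R.IsChain G.Adj)
    (ha : ∃ a ∈ L.getLast?, Touches G H a) (hb : ∀ b ∈ R.head?, Touches G H b)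
    (hp : ∀ K, p (L ++ (K ++ R))) : False := by
  obtain ⟨a, haL, k, hk, hak⟩ := ha
  obtain ⟨k', hk', hbk'⟩ : ∃ k' ∈ H, ∀ b ∈ R.head?, G.Adj b k' := by
    cases hhead : R.head? with
    | none => exact ⟨k, hk, by simp⟩
    | some b =>
      obtain ⟨k', hk', hbk'⟩ := hb b hhead
      exact ⟨k', hk', by simpa using hbk'⟩
  obtain ⟨K, hK, hKk, hKk', hKH⟩ := hH.exists_isPathList hk hk'
  have hKne : 0 < K.length := List.length_pos_of_mem (List.mem_of_head? hKk)
  have hpermK : (L ++ (K ++ R)).Perm (P ++ K) :=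
    (List.perm_append_comm.append_left L).trans
      (by rw [← List.append_assoc]; exact hperm.append_right K)
  have hnodup : (L ++ (K ++ R)).Nodup := hpermK.nodup_iff.2 <|
    hP.isPathList.nodup.append hK.nodup fun x hx hxK => hH.isDelClosed.notMem (hKH x hxK) hx
  have hchain : (L ++ (K ++ R)).IsChain G.Adj := by
    refine hL.append (hK.isChain.append hR ?_) ?_
    · intro x hx b hb
      obtain rfl : k' = x := by simpa [hKk'] using hx
      exact (hbk' b hb).symm
    · intro x hx y hy
      obtain rfl : a = x := Option.mem_unique haL hx
      obtain rfl : k = y := by simpa [hKk] using hy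
      exact hak
  have hle := hP.length_le ⟨hchain, hnodup⟩ (hp K)
  rw [hpermK.length_eq, List.length_append] at hle
  omega

theorem IsLongest.not_touches_of_append (hP : IsLongest G p P)
    (hends : ∀ l, l.head? = P.head? → l.getLast? = P.getLast? → p l)
    (hH : IsComponentOfDel G {x | x ∈ P} H) (hPe : P = L ++ R) (hL : L.getLast? = some a)
    (hR : R.head? = some b) (ha : Touches G H a) : ¬ Touches G H b := by
  intro hb
  have hchain := hPe ▸ hP.isPathList.isChain
  have hL' : L ≠ [] := by rintro rfl; cases hL
  have hR' : R ≠ [] := by rintro rfl; cases hR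
  rw [List.isChain_append] at hchain
  refine hP.false_of_perm hH (hPe ▸ .refl _) hchain.1 hchain.2.1 ⟨a, hL, ha⟩ (by simpa [hR])
    fun K => hends _ ?_ ?_
  · rw [hPe, List.head?_append_of_ne_nil _ hL', List.head?_append_of_ne_nil _ hL']
  · rw [hPe, ← List.append_assoc, List.getLast?_append_of_ne_nil _ hR',
      List.getLast?_append_of_ne_nil _ hR']

theorem IsLongest.exists_successors (hP : IsLongest G p P)
    (hends : ∀ l, l.head? = P.head? → l.getLast? = P.getLast? → p l)
    (hH : IsComponentOfDel G {x | x ∈ P} H) (hPe : P = U ++ s₁ :: (A ++ s₂ :: B)) (hB : B ≠ [])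
    (h₁ : Touches G H s₁) (h₂ : Touches G H s₂) :
    ∃ a b, A.head? = some a ∧ B.head? = some b ∧ ¬ Touches G H a ∧ ¬ Touches G H b ∧
      ¬ G.Adj a b := by
  obtain ⟨b, hb⟩ : ∃ b, B.head? = some b := ⟨_, List.head?_eq_some_head hB⟩
  obtain ⟨a, ha⟩ : ∃ a, A.head? = some a := by
    refine Option.ne_none_iff_exists'.1 fun hA => ?_
    rw [List.head?_eq_none_iff] at hA
    exact hP.not_touches_of_append hends hH (L := U ++ [s₁]) (R := s₂ :: B) (by simp [hPe, hA])
      (by simp) rfl h₁ h₂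
  refine ⟨a, b, ha, hb, ?_, ?_, fun hab => ?_⟩
  · exact hP.not_touches_of_append hends hH (L := U ++ [s₁]) (R := A ++ s₂ :: B) (by simp [hPe])
      (by simp) (by simp [ha]) h₁
  · exact hP.not_touches_of_append hends hH (L := U ++ s₁ :: (A ++ [s₂])) (R := B)
      (by simp [hPe]) (by simp [List.getLast?_cons]) hb h₂
  · have hchain := hPe ▸ hP.isPathList.isChain
    refine hP.false_of_perm hH (L := U ++ [s₁]) (R := (A ++ [s₂]).reverse ++ B) ?_ ?_ ?_
      ⟨s₁, by simp, h₁⟩ (by simpa) fun K => hends _ (by simp [hPe]) ?_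
    · classical
      grind
    · exact hchain.infix ⟨[], A ++ s₂ :: B, by simp⟩
    · refine (isChain_adj_reverse.2 (hchain.infix ⟨U ++ [s₁], B, by simp⟩)).append
        (hchain.infix ⟨U ++ s₁ :: (A ++ [s₂]), [], by simp⟩) ?_
      simpa [List.getLast?_cons, ha, hb]
    · simp [hPe, List.getLast?_append, List.getLast?_cons,
        List.getLast?_eq_some_getLast hB]

theorem IsLongest.not_touches_getLast (hP : IsLongest G (·.head? = some u) P)
    (hH : IsComponentOfDel G {x | x ∈ P} H) (ht : P.getLast? = some t) : ¬ Touches G H t := by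
  intro h
  refine hP.false_of_perm hH (R := []) (by simp) hP.isPathList.isChain .nil ⟨t, ht, h⟩ (by simp)
    fun K => ?_
  simp [List.head?_append, hP.prop]

theorem IsLongest.not_adj_getLast (hP : IsLongest G (·.head? = some u) P)
    (hH : IsComponentOfDel G {x | x ∈ P} H) (hPe : P = U ++ s :: B) (hs : Touches G H s)
    (hc : U.getLast? = some c) (ht : B.getLast? = some t) : ¬ G.Adj c t := by
  intro hct
  have hU : U ≠ [] := by rintro rfl; cases hc
  refine hP.false_of_perm hH (L := U ++ (B.reverse ++ [s])) (R := []) ?_ ?_ .nil ⟨s, by simp, hs⟩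
    (by simp) fun K => ?_
  · classical
    grind
  · have hchain := hPe ▸ hP.isPathList.isChain
    have hsB : (B.reverse ++ [s]).IsChain G.Adj := by
      simpa using isChain_adj_reverse.2 (hchain.infix ⟨U, [], by simp⟩ : (s :: B).IsChain G.Adj)
    refine (hchain.infix ⟨[], s :: B, by simp⟩).append hsB ?_
    simpa [List.head?_append, hc, ht]
  · rw [List.append_assoc, ← hP.prop, hPe, List.head?_append_of_ne_nil _ hU,
      List.head?_append_of_ne_nil _ hU]

theorem IsLongest.exists_successors_of_head? (hP : IsLongest G (·.head? = some u) P)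
    (hH : IsComponentOfDel G {x | x ∈ P} H) (hPe : P = U ++ s₁ :: (A ++ s₂ :: B))
    (h₁ : Touches G H s₁) (h₂ : Touches G H s₂) :
    ∃ a b, A.head? = some a ∧ B.head? = some b ∧ ¬ Touches G H a ∧ ¬ Touches G H b ∧
      ¬ G.Adj a b := by
  refine hP.exists_successors (fun l hl _ => hl.trans hP.prop) hH hPe ?_ h₁ h₂
  rintro rfl
  exact hP.not_touches_getLast hH (t := s₂) (by simp [hPe, List.getLast?_cons]) h₂

theorem IsLongest.not_adj_succ_getLast (hP : IsLongest G (·.head? = some u) P)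
    (hH : IsComponentOfDel G {x | x ∈ P} H) (hPe : P = U ++ s₁ :: (A ++ s₂ :: B)) (hU : U ≠ [])
    (h₁ : Touches G H s₁) (h₂ : Touches G H s₂) (ha : A.head? = some a)
    (ht : B.getLast? = some t) : ¬ G.Adj a t := by
  intro hat
  have hchain := hPe ▸ hP.isPathList.isChain
  refine hP.false_of_perm hH (L := U ++ [s₁]) (R := (A ++ [s₂]).reverse ++ B.reverse) ?_
    (hchain.infix ⟨[], A ++ s₂ :: B, by simp⟩) ?_ ⟨s₁, by simp, h₁⟩ (by simpa) fun K => ?_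
  · classical
    grind
  · refine (isChain_adj_reverse.2 (hchain.infix ⟨U ++ [s₁], B, by simp⟩)).append
      (isChain_adj_reverse.2 (hchain.infix ⟨U ++ s₁ :: (A ++ [s₂]), [], by simp⟩)) ?_
    simpa [List.getLast?_cons, ha, ht]
  · rw [← hP.prop, hPe, List.append_assoc, List.head?_append_of_ne_nil _ hU,
      List.head?_append_of_ne_nil _ hU]

theorem IsLongest.not_adj_pred_pred (hP : IsLongest G (·.head? = some u) P)
    (hH : IsComponentOfDel G {x | x ∈ P} H) (hPe : P = U ++ s₁ :: (A ++ s₂ :: B))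
    (h₁ : Touches G H s₁) (h₂ : Touches G H s₂) (hc : U.getLast? = some c)
    (ha : A.getLast? = some a) : ¬ G.Adj c a := by
  intro hca
  have hchain := hPe ▸ hP.isPathList.isChain
  have hU : U ≠ [] := by rintro rfl; cases hc
  refine hP.false_of_perm hH (L := U ++ (s₁ :: A).reverse) (R := s₂ :: B) ?_ ?_
    (hchain.infix ⟨U ++ s₁ :: A, [], by simp⟩) ⟨s₁, by simp, h₁⟩ (by simpa) fun K => ?_
  · classical
    grind
  · refine (hchain.infix ⟨[], s₁ :: (A ++ s₂ :: B), by simp⟩).append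
      (isChain_adj_reverse.2 (hchain.infix ⟨U, s₂ :: B, by simp⟩)) ?_
    simpa [List.getLast?_cons, hc, ha]
  · rw [← hP.prop, hPe, List.append_assoc, List.head?_append_of_ne_nil _ hU,
      List.head?_append_of_ne_nil _ hU]

theorem IsLongest.not_adj_and_adj (hP : IsLongest G (·.head? = some u) P)
    (hH : IsComponentOfDel G {x | x ∈ P} H) (hPe : P = U ++ s₁ :: (A ++ s₂ :: B))
    (h₁ : Touches G H s₁) (h₂ : Touches G H s₂) (hc : U.getLast? = some c)
    (ha : A.head? = some a) (ha' : A.getLast? = some b) (ht : B.getLast? = some t) :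
    ¬ (G.Adj c a ∧ G.Adj b t) := by
  rintro ⟨hca, hbt⟩
  have hchain := hPe ▸ hP.isPathList.isChain
  have hU : U ≠ [] := by rintro rfl; cases hc
  refine hP.false_of_perm hH (L := U ++ (A ++ (s₂ :: B).reverse)) (R := [s₁]) ?_ ?_ (.singleton _)
    ⟨s₂, by simp, h₂⟩ (by simpa) fun K => ?_
  · classical
    grind
  · refine (hchain.infix ⟨[], s₁ :: (A ++ s₂ :: B), by simp⟩).append
      ((hchain.infix ⟨U ++ [s₁], s₂ :: B, by simp⟩).append
        (isChain_adj_reverse.2 (hchain.infix ⟨U ++ s₁ :: A, [], by simp⟩)) ?_) ?_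
    · simpa [ha', ht]
    · simpa [hc, ha]
  · rw [← hP.prop, hPe, List.append_assoc, List.head?_append_of_ne_nil _ hU,
      List.head?_append_of_ne_nil _ hU]

theorem IsLongest.eq_nil_of_touches_of_touches (hG : IsKK1Free 4 G)
    (hP : IsLongest G (·.head? = some u) P)
    (hH : IsComponentOfDel G {x | x ∈ P} H) (hPe : P = U ++ s₁ :: (A ++ s₂ :: B))
    (h₁ : Touches G H s₁) (h₂ : Touches G H s₂) : U = [] := by
  by_contra hU
  have hends : ∀ l : List V, l.head? = P.head? → l.getLast? = P.getLast? → l.head? = some u :=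
    fun l hl _ => hl.trans hP.prop
  obtain ⟨a, b, ha, hb, haH, -, -⟩ := hP.exists_successors_of_head? hH hPe h₁ h₂
  have hB : B ≠ [] := by rintro rfl; cases hb
  have hA : A ≠ [] := by rintro rfl; cases ha
  obtain ⟨c, hc⟩ : ∃ c, U.getLast? = some c := ⟨_, List.getLast?_eq_some_getLast hU⟩
  obtain ⟨a', ha'⟩ : ∃ a', A.getLast? = some a' := ⟨_, List.getLast?_eq_some_getLast hA⟩
  obtain ⟨t, ht⟩ : ∃ t, B.getLast? = some t := ⟨_, List.getLast?_eq_some_getLast hB⟩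
  have hcH : ¬ Touches G H c := fun hcH =>
    hP.not_touches_of_append hends hH hPe hc rfl hcH h₁
  have ha'H : ¬ Touches G H a' := fun ha'H =>
    hP.not_touches_of_append hends hH (L := U ++ s₁ :: A) (R := s₂ :: B) (by simp [hPe])
      (by simp [List.getLast?_cons, ha']) rfl ha'H h₂
  have htH : ¬ Touches G H t := hP.not_touches_getLast hH (by simp [hPe, List.getLast?_cons, ht])
  have hct : ¬ G.Adj c t := hP.not_adj_getLast hH hPe h₁ hc (by simp [List.getLast?_cons, ht])
  have hat : ¬ G.Adj a t := hP.not_adj_succ_getLast hH hPe hU h₁ h₂ ha ht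
  have hca' : ¬ G.Adj c a' := hP.not_adj_pred_pred hH hPe h₁ h₂ hc ha'
  have hcat := hP.not_adj_and_adj hH hPe h₁ h₂ hc ha ha' ht
  obtain ⟨h, hh⟩ := hH.nonempty
  have hhP : h ∉ P := hH.isDelClosed.notMem hh
  have hnodup := hP.isPathList.nodup
  have hcU := List.mem_of_getLast? hc
  have haA := List.mem_of_head? ha
  have ha'A := List.mem_of_getLast? ha'
  have htB := List.mem_of_getLast? ht
  have hhz : ∀ z, ¬ Touches G H z → ¬ G.Adj h z := fun z hz hhz => hz ⟨h, hh, hhz.symm⟩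
  -- `{h, c, a, t}` or `{h, c, a', t}` is independent.
  have hindep := hG.not_pairwise_not_adj (l := [h, c, a, t]) (by grind) rfl
  have hindep' := hG.not_pairwise_not_adj (l := [h, c, a', t]) (by grind) rfl
  grind

end LongestPaths

section IndependenceNumberTwo

variable {p : List V → Prop} {P U A B : List V} {H : Set V} {a b s s₁ s₂ u v : V}

theorem exists_eq_append_cons_append_cons {q : V → Prop} {l : List V} (ha : a ∈ l)
    (hb : b ∈ l) (hab : a ≠ b) (hqa : q a) (hqb : q b) :
    ∃ l₁ c l₂ d l₃, l = l₁ ++ c :: (l₂ ++ d :: l₃) ∧ q c ∧ q d := by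
  obtain ⟨l₁, l₂, rfl⟩ := List.append_of_mem ha
  obtain hb | hb := List.mem_append.1 hb
  · obtain ⟨l₁, l₃, rfl⟩ := List.append_of_mem hb
    exact ⟨l₁, b, l₃, a, l₂, by simp, hqb, hqa⟩
  · obtain ⟨l₂, l₃, rfl⟩ := List.append_of_mem (List.mem_of_ne_of_mem hab.symm hb)
    exact ⟨l₁, a, l₂, b, l₃, rfl, hqa, hqb⟩

theorem IsLongest.eq_nil_right_of_touches (hG : IsKK1Free 3 G) (hP : IsLongest G p P)
    (hends : ∀ l, l.head? = P.head? → l.getLast? = P.getLast? → p l)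
    (hH : IsComponentOfDel G {x | x ∈ P} H) (hPe : P = U ++ s₁ :: (A ++ s₂ :: B))
    (h₁ : Touches G H s₁) (h₂ : Touches G H s₂) : B = [] := by
  by_contra hB
  obtain ⟨a, b, ha, hb, haH, hbH, hab⟩ := hP.exists_successors hends hH hPe hB h₁ h₂
  obtain ⟨h, hh⟩ := hH.nonempty
  have hhP : h ∉ P := hH.isDelClosed.notMem hh
  have hnodup := hP.isPathList.nodup
  have haA := List.mem_of_head? ha
  have hbB := List.mem_of_head? hb
  have hhz : ∀ z, ¬ Touches G H z → ¬ G.Adj h z := fun z hz hhz => hz ⟨h, hh, hhz.symm⟩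
  have := hG.not_pairwise_not_adj (l := [h, a, b]) (by grind) rfl
  grind

theorem IsLongest.eq_nil_left_of_touches (hG : IsKK1Free 3 G) (hP : IsLongest G p P)
    (hends : ∀ l, l.head? = P.head? → l.getLast? = P.getLast? → p l)
    (hH : IsComponentOfDel G {x | x ∈ P} H) (hPe : P = U ++ s₁ :: (A ++ s₂ :: B))
    (h₁ : Touches G H s₁) (h₂ : Touches G H s₂) : U = [] := by
  rw [← List.reverse_eq_nil_iff]
  refine hP.reverse.eq_nil_right_of_touches (U := B.reverse) (A := A.reverse) hG ?_ ?_ ?_ h₂ h₁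
  · exact fun l hl hl' => hends _ (by simpa using hl') (by simpa using hl)
  · simpa only [List.mem_reverse] using hH
  · simp [hPe]

theorem IsLongest.eq_nil_of_touches (hG : IsKK1Free 3 G)
    (hP : IsLongest G (·.head? = some u) P) (hH : IsComponentOfDel G {x | x ∈ P} H)
    (hPe : P = U ++ s :: B) (hs : Touches G H s) : U = [] := by
  by_contra hU
  have hB : B ≠ [] := by
    rintro rfl
    exact hP.not_touches_getLast hH (by simp [hPe]) hs
  obtain ⟨c, hc⟩ : ∃ c, U.getLast? = some c := ⟨_, List.getLast?_eq_some_getLast hU⟩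
  obtain ⟨t, ht⟩ : ∃ t, B.getLast? = some t := ⟨_, List.getLast?_eq_some_getLast hB⟩
  have hcH : ¬ Touches G H c := fun hcH =>
    hP.not_touches_of_append (fun l hl _ => hl.trans hP.prop) hH hPe hc rfl hcH hs
  have htH : ¬ Touches G H t := hP.not_touches_getLast hH (by simp [hPe, List.getLast?_cons, ht])
  have hct : ¬ G.Adj c t := hP.not_adj_getLast hH hPe hs hc ht
  obtain ⟨h, hh⟩ := hH.nonempty
  have hhP : h ∉ P := hH.isDelClosed.notMem hh
  have hnodup := hP.isPathList.nodup
  have hcU := List.mem_of_getLast? hc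
  have htB := List.mem_of_getLast? ht
  have hhz : ∀ z, ¬ Touches G H z → ¬ G.Adj h z := fun z hz hhz => hz ⟨h, hh, hhz.symm⟩
  have := hG.not_pairwise_not_adj (l := [h, c, t]) (by grind) rfl
  grind

theorem exists_isHamPathList_of_not_isArticulationPoint [Finite V] (hG : IsKK1Free 3 G)
    (hc : G.Preconnected) (hu : ¬ IsArticulationPoint G u) : ∃ v l, IsHamPathList G u v l := by
  obtain ⟨P, hP⟩ := exists_isLongest (G := G) (p := (·.head? = some u)) (l := [u])
    ⟨.singleton u, List.nodup_singleton u⟩ rfl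
  have huP : u ∈ P := List.mem_of_head? hP.prop
  obtain ⟨t, ht⟩ : ∃ t, P.getLast? = some t :=
    ⟨_, List.getLast?_eq_some_getLast (List.ne_nil_of_mem huP)⟩
  have htP : t ∈ P := List.mem_of_getLast? ht
  refine ⟨t, P, hP.isPathList, hP.prop, ht, ?_⟩
  by_contra! ⟨h, hhP⟩
  obtain ⟨H, hH, hh⟩ := exists_isComponentOfDel (G := G) (A := {x | x ∈ P}) hhP
  obtain ⟨s, hsP, hsu, hs⟩ : ∃ s ∈ P, s ≠ u ∧ Touches G H s := by
    obtain ⟨s, hsP, -, hs⟩ := hH.isDelClosed.exists_touches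
      (by simpa only [isVertexCut_empty_iff, not_not] using hc) hh (Set.disjoint_empty H)
      (fun huH => hH.isDelClosed.notMem huH huP) (Set.notMem_empty u)
    obtain rfl | hsu := eq_or_ne s u
    · exact hH.exists_touches_ne hu hsP htP fun hts => hP.not_touches_getLast hH ht (hts ▸ hs)
    · exact ⟨s, hsP, hsu, hs⟩
  obtain ⟨U, B, hPe⟩ := List.append_of_mem hsP
  obtain rfl := hP.eq_nil_of_touches hG hH hPe hs
  exact hsu (by simpa [hPe] using hP.prop)

theorem exists_isHamPathList_of_not_isVertexCut [Finite V] (hG : IsKK1Free 3 G)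
    (hc : G.Preconnected) (hart : ∀ y, ¬ IsArticulationPoint G y) (huv : u ≠ v)
    (hcut : ¬ IsVertexCut G {u, v}) : ∃ l, IsHamPathList G u v l := by
  obtain ⟨l, hl, hlu, hlv⟩ := exists_isPathList_of_preconnected hc u v
  obtain ⟨P, hP⟩ := exists_isLongest (p := fun l => l.head? = some u ∧ l.getLast? = some v)
    hl ⟨hlu, hlv⟩
  refine ⟨P, hP.isPathList, hP.prop.1, hP.prop.2, ?_⟩
  by_contra! ⟨h, hhP⟩
  obtain ⟨H, hH, hh⟩ := exists_isComponentOfDel (G := G) (A := {x | x ∈ P}) hhP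
  have huP : u ∈ P := List.mem_of_head? hP.prop.1
  have hvP : v ∈ P := List.mem_of_getLast? hP.prop.2
  have hends : ∀ l : List V, l.head? = P.head? → l.getLast? = P.getLast? →
      l.head? = some u ∧ l.getLast? = some v :=
    fun l hl hl' => ⟨hl.trans hP.prop.1, hl'.trans hP.prop.2⟩
  obtain ⟨z, hzP, hzu, hz⟩ := hH.exists_touches_ne (hart u) huP hvP huv.symm
  obtain ⟨z', hzP', hzz', hz'⟩ := hH.exists_touches_ne (hart z) hzP huP hzu.symm
  obtain ⟨U, s₁, A, s₂, B, hPe, h₁, h₂⟩ :=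
    exists_eq_append_cons_append_cons hzP hzP' hzz'.symm hz hz'
  obtain rfl := hP.eq_nil_left_of_touches hG hends hH hPe h₁ h₂
  obtain rfl := hP.eq_nil_right_of_touches hG hends hH hPe h₁ h₂
  obtain rfl : s₁ = u := by simpa [hPe] using hP.prop.1
  obtain rfl : s₂ = v := by simpa [hPe, List.getLast?_cons] using hP.prop.2
  have hnodup := hP.isPathList.nodup
  -- An interior vertex of `P` that touches `H` would give a touching pair not ending at `v`.
  have hA : ∀ x ∈ A, ¬ Touches G H x := by
    intro x hxA hx
    obtain ⟨A₁, A₂, rfl⟩ := List.append_of_mem hxA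
    have := hP.eq_nil_right_of_touches (U := []) (A := A₁) (B := A₂ ++ [s₂]) hG hends hH
      (by simp [hPe]) h₁ hx
    simp at this
  obtain ⟨w, hw⟩ : ∃ w, w ∈ A := by
    refine List.exists_mem_of_ne_nil A ?_
    rintro rfl
    exact hP.not_touches_of_append hends hH (L := [s₁]) (R := [s₂]) hPe rfl rfl h₁ h₂
  obtain ⟨x, hxP, hxS, hx⟩ := hH.isDelClosed.exists_touches hcut hh
    (Set.disjoint_right.2 fun y hy hyH => hH.isDelClosed.notMem hyH (by grind))
    (fun hwH => hH.isDelClosed.notMem hwH (by grind)) (show w ∉ ({s₁, s₂} : Set V) by grind)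
  exact hA x (by grind) hx

end IndependenceNumberTwo

section PrescribedEnds

variable {A N Q X : Set V} {L M : List V} {a m t u v x y : V}

theorem IsHamPathList.mem_or_mem_iff (h : IsHamPathList G u t (L ++ x :: M)) (v : V) :
    v ∈ L ∨ v ∈ M ↔ v ∉ ({x} : Set V) := by
  have := h.isPathList.nodup
  have := h.mem v
  grind

theorem IsHamPathList.mem_left (h : IsHamPathList G u t (L ++ x :: M)) (hxu : x ≠ u) : u ∈ L := by
  cases L with
  | nil => exact absurd (by simpa using h.head?) hxu
  | cons a L => exact List.mem_of_head? h.head?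

theorem IsHamPathList.mem_iff_mem_left (h : IsHamPathList G a t (L ++ x :: M))
    (hx : IsArticulationPoint G x) (hQ : IsComponentOfDel G {x} Q) (huL : u ∈ L) (huQ : u ∈ Q)
    (v : V) : v ∈ Q ↔ v ∈ L := by
  have hchain := h.isPathList.isChain
  exact hQ.mem_iff_mem_chain hx hchain.left_of_append hchain.right_of_append.tail
    h.mem_or_mem_iff huL huQ v

theorem IsHamPathList.isDelClosed_right (h : IsHamPathList G u t (L ++ x :: M)) (hxu : x ≠ u)
    (hx : IsArticulationPoint G x) : IsDelClosed G {x} {v | v ∈ M} := by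
  obtain ⟨Q, hQ, huQ⟩ := exists_isComponentOfDel (G := G) (show u ∉ {x} from hxu.symm)
  have hmem := h.mem_or_mem_iff
  have hL := h.mem_iff_mem_left hx hQ (h.mem_left hxu) huQ
  have hnodup := h.isPathList.nodup
  refine ⟨fun hv => (hmem _).1 (.inr hv), fun {v w} hv hvw hw => ?_⟩
  refine ((hmem w).2 hw).resolve_left fun hwL => ?_
  have hvL : v ∈ L := (hL v).1 <|
    hQ.isDelClosed.mem_of_adj ((hL w).2 hwL) hvw.symm ((hmem v).1 (.inr hv))
  grind

theorem exists_isPathList_of_isClique [Finite V] (hQ : G.IsClique Q) (hm : m ∈ Q) (hv : v ∈ Q)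
    (hmv : m ≠ v ∨ Q = {v}) :
    ∃ M, IsPathList G M ∧ M.head? = some m ∧ M.getLast? = some v ∧ ∀ w, w ∈ M ↔ w ∈ Q := by
  obtain hmv | rfl := hmv
  · have hmid : ∀ w, w ∈ (Set.toFinite (Q \ {m, v})).toFinset.toList ↔ w ∈ Q \ {m, v} := by simp
    refine ⟨m :: ((Set.toFinite (Q \ {m, v})).toFinset.toList ++ [v]), ?_, rfl,
      by simp [List.getLast?_cons], by grind⟩
    have hnodup : (m :: ((Set.toFinite (Q \ {m, v})).toFinset.toList ++ [v])).Nodup := by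
      have := (Set.toFinite (Q \ {m, v})).toFinset.nodup_toList
      grind
    exact ⟨(hnodup.imp_of_mem fun ha hb hab => hQ (by grind) (by grind) hab).isChain, hnodup⟩
  · exact ⟨[v], ⟨.singleton v, List.nodup_singleton v⟩, by simpa using hm.symm, rfl, by simp⟩

theorem IsDelClosed.insert_diff_singleton (hX : IsDelClosed G (insert a A) X)
    (ha : ∀ z ∈ X, G.Adj a z → z = m) : IsDelClosed G (insert m A) (X \ {m}) where
  notMem hv := by
    have := hX.notMem hv.1
    grind
  mem_of_adj {v w} hv hvw hw := by
    have hwa : w ≠ a := by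
      rintro rfl
      exact hv.2 (ha v hv.1 hvw.symm)
    exact ⟨hX.mem_of_adj hv.1 hvw (by grind), by grind⟩

theorem exists_distinct_representatives (hm : ∃ m ∈ Q, m ∈ X) (hv : ∃ v ∈ Q, v ∈ N)
    (h : ∀ m ∈ Q, (∀ z ∈ Q, z ∈ X → z = m) → Q ≠ {m} → ∃ v ∈ Q, v ∈ N ∧ v ≠ m) :
    ∃ m ∈ Q, m ∈ X ∧ ∃ v ∈ Q, v ∈ N ∧ (m ≠ v ∨ Q = {v}) := by
  obtain ⟨m, hmQ, hmX⟩ := hm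
  obtain ⟨v, hvQ, hvN⟩ := hv
  by_cases hall : ∀ z ∈ Q, z ∈ X → z = m
  · by_cases hQ : Q = {m}
    · obtain rfl : v = m := by simpa [hQ] using hvQ
      exact ⟨v, hvQ, hmX, v, hvQ, hvN, .inr hQ⟩
    · obtain ⟨w, hwQ, hwN, hwm⟩ := h m hmQ hall hQ
      exact ⟨m, hmQ, hmX, w, hwQ, hwN, .inl hwm.symm⟩
  · push Not at hall
    obtain ⟨z, hzQ, hzX, hzm⟩ := hall
    obtain hmv | rfl := ne_or_eq m v
    · exact ⟨m, hmQ, hmX, v, hvQ, hvN, .inl hmv⟩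
    · exact ⟨z, hzQ, hzX, m, hvQ, hvN, .inl hzm⟩

theorem IsHamPathList.isClique_right (hG : IsKK1Free 3 G)
    (h : IsHamPathList G u t (L ++ x :: M)) (hxu : x ≠ u) (hx : IsArticulationPoint G x) :
    G.IsClique {v | v ∈ M} := by
  intro v hv w hw hvw
  by_contra hadj
  have hM := h.isDelClosed_right hxu hx
  have huM : u ∉ M := by
    have := h.mem_left hxu
    have := h.isPathList.nodup
    grind
  have huadj : ∀ z ∈ M, ¬ G.Adj u z := fun z hz huz => huM (hM.mem_of_adj hz huz.symm hxu.symm)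
  have := hG.not_pairwise_not_adj (l := [u, v, w]) (by grind) rfl
  grind

theorem IsHamPathList.mem_right_of_inDifferentComponents
    (h : IsHamPathList G u t (L ++ x :: M)) (hxu : x ≠ u)
    (hv : InDifferentComponents G {x} u v) : v ∈ M := by
  refine ((h.mem_or_mem_iff v).2 hv.2.1).resolve_left fun hvL => ?_
  exact not_inDifferentComponents_of_isChain h.isPathList.isChain.left_of_append
    (fun w hw => (h.mem_or_mem_iff w).1 (.inl hw)) (h.mem_left hxu) hvL hv

theorem IsHamPathList.replace_right {M' : List V} (h : IsHamPathList G u t (L ++ x :: M))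
    (hxu : x ≠ u) (hM' : IsPathList G M') (hm : M'.head? = some m) (hxm : G.Adj x m)
    (hv : M'.getLast? = some v) (hmem : ∀ w, w ∈ M' ↔ w ∈ M) :
    IsHamPathList G u v (L ++ x :: M') := by
  obtain ⟨hL, hxM, hLx, hdisj⟩ := isPathList_append.1 h.isPathList
  refine ⟨isPathList_append.2 ⟨hL, isPathList_cons.2 ⟨by simpa [hm] using hxm, ?_, hM'⟩, hLx, ?_⟩,
    ?_, by simp [List.getLast?_cons, hv], fun w => ?_⟩
  · exact fun hx => (isPathList_cons.1 hxM).2.1 ((hmem x).1 hx)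
  · exact fun w hw hw' => hdisj hw (by simpa only [List.mem_cons, hmem] using hw')
  · have hL := List.ne_nil_of_mem (h.mem_left hxu)
    rw [← h.head?, List.head?_append_of_ne_nil _ hL, List.head?_append_of_ne_nil _ hL]
  · simpa only [List.mem_append, List.mem_cons, hmem] using h.mem w

-- If `x` has a single neighbour `m` in `M`, then `m` is again an articulation point.
theorem IsHamPathList.exists_adj_mem_right (h : IsHamPathList G u t (L ++ x :: M)) (hxu : x ≠ u)
    (hx : IsArticulationPoint G x)
    (hN : ∀ y ≠ u, IsArticulationPoint G y → ∃ v ∈ N, InDifferentComponents G {y} u v) :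
    ∃ m ∈ {z | z ∈ M}, m ∈ {z | G.Adj x z} ∧
      ∃ v ∈ {z | z ∈ M}, v ∈ N ∧ (m ≠ v ∨ {z | z ∈ M} = {v}) := by
  have hM := h.isDelClosed_right hxu hx
  have huL := h.mem_left hxu
  obtain ⟨hchain, hnodup⟩ := h.isPathList
  obtain ⟨v, hvN, hv⟩ := hN x hxu hx
  have hvM := h.mem_right_of_inDifferentComponents hxu hv
  refine exists_distinct_representatives ?_ ⟨v, hvM, hvN⟩ fun m hm hxm hMm => ?_
  · obtain ⟨m, hm⟩ : ∃ m, M.head? = some m :=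
      ⟨_, List.head?_eq_some_head (List.ne_nil_of_mem hvM)⟩
    exact ⟨m, List.mem_of_head? hm, (List.isChain_cons.1 hchain.right_of_append).1 m hm⟩
  · have hML : ∀ v ∈ M, v ∉ L := by grind
    have hmx : m ≠ x := hM.notMem hm
    have hmu : m ≠ u := fun hmu => hML m hm (hmu ▸ huL)
    obtain ⟨z, hz, hzm⟩ := ((Set.nontrivial_iff_ne_singleton hm).2 hMm).exists_ne m
    have hX := IsDelClosed.insert_diff_singleton (A := ∅) (by simpa using hM) hxm
    rw [insert_empty_eq] at hX
    obtain ⟨v, hvN, hv⟩ := hN m hmu <| hX.isVertexCut (v := u) ⟨hz, hzm⟩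
      (fun hu => hML u hu.1 huL) hmu.symm
    refine ⟨v, by_contra fun hvM => ?_, hvN, hv.2.1⟩
    have hvL : v ∈ L ++ [x] := by
      have := h.mem v
      have : v ∉ M := hvM
      grind
    refine not_inDifferentComponents_of_isChain (hchain.infix ⟨[], M, by simp⟩)
      (fun w hw => ?_) (List.mem_append_left _ huL) hvL hv
    rw [Set.mem_singleton_iff]
    have := hML m hm
    grind

theorem exists_isHamPathList_to [Finite V] (hG : IsKK1Free 3 G)
    (hc : G.Preconnected) (hu : ¬ IsArticulationPoint G u)
    (hN : ∀ y ≠ u, IsArticulationPoint G y → ∃ v ∈ N, InDifferentComponents G {y} u v)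
    (hN₂ : (∀ y, ¬ IsArticulationPoint G y) → (∃ w, w ≠ u) →
      ∃ v ∈ N, v ≠ u ∧ ¬ IsVertexCut G {u, v})
    (hN₁ : (∀ w, w = u) → u ∈ N) :
    ∃ v ∈ N, ∃ l, IsHamPathList G u v l := by
  by_cases hart : ∃ y, IsArticulationPoint G y
  · obtain ⟨y, hy⟩ := hart
    have hyu : y ≠ u := fun hyu => hu (hyu ▸ hy)
    obtain ⟨t, l, hl⟩ := exists_isHamPathList_of_not_isArticulationPoint hG hc hu
    obtain ⟨L, M, rfl⟩ := List.append_of_mem (hl.mem y)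
    obtain ⟨m, hm, hym, v, hv, hvN, hmv⟩ := hl.exists_adj_mem_right hyu hy hN
    obtain ⟨M', hM', hM'm, hM'v, hmem⟩ :=
      exists_isPathList_of_isClique (hl.isClique_right hG hyu hy) hm hv hmv
    exact ⟨v, hvN, _, hl.replace_right hyu hM' hM'm hym hM'v hmem⟩
  · push Not at hart
    by_cases hw : ∃ w, w ≠ u
    · obtain ⟨v, hvN, hvu, hcut⟩ := hN₂ hart hw
      exact ⟨v, hvN, exists_isHamPathList_of_not_isVertexCut hG hc hart hvu.symm hcut⟩
    · push Not at hw
      exact ⟨u, hN₁ hw, [u], ⟨.singleton u, List.nodup_singleton u⟩, rfl, rfl, by simpa using hw⟩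

end PrescribedEnds

section Sufficiency

variable {Q : Set V} {u x : V}

theorem CondE.not_isArticulationPoint_induce [Finite V] (hE : CondE G u)
    (hx : IsArticulationPoint G x) (hQ : IsComponentOfDel G {x} Q) (huQ : u ∈ Q) :
    ¬ IsArticulationPoint (G.induce Q) ⟨u, huQ⟩ := by
  intro hu
  obtain ⟨v, hvx, hvQ⟩ := hx.exists_notMem_component hQ
  have h3 := hQ.isDelClosed.three_le_numComponents hu hvQ hvx
  rw [Set.image_singleton, Set.singleton_union, Set.pair_comm] at h3
  exact hE ⟨x, h3⟩

theorem CondD.exists_adj_not_isVertexCut [Finite V] (hD : CondD G u) (hxu : x ≠ u)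
    (hu : ¬ IsArticulationPoint G u) (hx : IsArticulationPoint G x)
    (hQ : IsComponentOfDel G {x} Q) (huQ : u ∈ Q)
    (hart : ∀ y, ¬ IsArticulationPoint (G.induce Q) y) (hw : ∃ w : Q, w ≠ ⟨u, huQ⟩) :
    ∃ v : Q, G.Adj x v ∧ v ≠ ⟨u, huQ⟩ ∧ ¬ IsVertexCut (G.induce Q) {⟨u, huQ⟩, v} := by
  by_cases h2 : IsTwoConnected (G.induce Q)
  · obtain ⟨v, hxv, hvu, hcut⟩ := hD x hxu hx Q hQ huQ h2
    exact ⟨v, hxv, hvu, fun h => hcut (h2.isMinVertexCut_pair h)⟩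
  have hxQ : x ∉ Q := fun h => hQ.isDelClosed.notMem h rfl
  obtain ⟨w, hwu⟩ := hw
  obtain ⟨z, hz, hzu, v, ⟨hvQ, hvu⟩, hzv⟩ := (hQ.isDelClosed.diff {u}).exists_touches hu
    ⟨w.2, fun hw => hwu (Subtype.ext hw)⟩ Set.disjoint_sdiff_left (fun h => hxQ h.1) hxu
  obtain rfl : z = x := hz.resolve_right hzu
  have hvu' : (⟨v, hvQ⟩ : Q) ≠ ⟨u, huQ⟩ := fun h => hvu (congrArg Subtype.val h)
  exact ⟨⟨v, hvQ⟩, hzv, hvu', fun hcut =>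
    h2 (isTwoConnected_of_isVertexCut_pair hQ.preconnected hart hvu'.symm hcut)⟩

theorem exists_isHamPathList_induce_component [Finite V] (hG : IsKK1Free 4 G)
    (hc : G.Preconnected) (hu : ¬ IsArticulationPoint G u) (hC : CondC G u) (hD : CondD G u)
    (hE : CondE G u) (hx : IsArticulationPoint G x) (hQ : IsComponentOfDel G {x} Q)
    (huQ : u ∈ Q) : ∃ v : Q, G.Adj x v ∧ ∃ l, IsHamPathList (G.induce Q) ⟨u, huQ⟩ v l := by
  have hxu : x ≠ u := fun hxu => hu (hxu ▸ hx)
  obtain ⟨m, hmx, hmQ⟩ := hx.exists_notMem_component hQ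
  have hm : ¬ Touches G Q m := fun ⟨k, hk, hmk⟩ =>
    hmQ (hQ.isDelClosed.mem_of_adj hk hmk.symm hmx)
  refine exists_isHamPathList_to (N := {v : Q | G.Adj x v}) (hG.induce_of_not_touches hmQ hm)
    hQ.preconnected (hE.not_isArticulationPoint_induce hx hQ huQ) (fun y hyu hy => ?_)
    (hD.exists_adj_not_isVertexCut hxu hu hx hQ huQ) fun hall => ?_
  · exact hC x hxu hx Q hQ huQ (fun h2 => (isTwoConnected_iff.1 h2).2.2 y hy) y hyu hy
  · obtain ⟨z, rfl, -, v, hvQ, hzv⟩ := hQ.isDelClosed.exists_touches (S := ∅)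
      (by simpa only [isVertexCut_empty_iff, not_not] using hc) huQ (Set.disjoint_empty Q) hmQ
      (Set.notMem_empty m)
    exact hall ⟨v, hvQ⟩ ▸ hzv

theorem IsHamPathList.replace_left {a t : V} {L M : List V} {v w : Q} {l : List Q}
    (h : IsHamPathList G a t (L ++ x :: M)) (hQL : ∀ z, z ∈ Q ↔ z ∈ L)
    (hl : IsHamPathList (G.induce Q) v w l) (hxw : G.Adj x w) :
    IsHamPathList G v t (l.map Subtype.val ++ x :: M) := by
  obtain ⟨-, hxM, -, hdisj⟩ := isPathList_append.1 h.isPathList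
  have hmem : ∀ z, z ∈ l.map Subtype.val ↔ z ∈ L := fun z => hl.mem_map_val.trans (hQL z)
  refine ⟨isPathList_append.2 ⟨hl.isPathList.map_val, hxM, ?_, ?_⟩, ?_, ?_, fun z => ?_⟩
  · rw [List.getLast?_map, hl.getLast?]
    simpa using hxw.symm
  · exact fun z hz => hdisj ((hmem z).1 hz)
  · rw [List.head?_append, List.head?_map, hl.head?, Option.map_some, Option.some_or]
  · simpa using h.getLast?
  · simpa only [List.mem_append, hmem] using h.mem z

theorem exists_isHamPathList_of_isArticulationPoint [Finite V] (hG : IsKK1Free 4 G)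
    (hc : G.Preconnected) (hu : ¬ IsArticulationPoint G u) (hC : CondC G u) (hD : CondD G u)
    (hE : CondE G u) (hx : IsArticulationPoint G x) {a t : V} {l : List V}
    (hl : IsHamPathList G a t l) : ∃ v l, IsHamPathList G u v l := by
  obtain ⟨Q, hQ, huQ⟩ := exists_isComponentOfDel (G := G) (A := {x}) (u := u)
    fun hux => hu (hux ▸ hx)
  obtain ⟨w, hxw, l', hl'⟩ := exists_isHamPathList_induce_component hG hc hu hC hD hE hx hQ huQ
  obtain ⟨L, M, rfl⟩ := List.append_of_mem (hl.mem x)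
  obtain huL | huM := (hl.mem_or_mem_iff u).2 (hQ.isDelClosed.notMem huQ)
  · exact ⟨_, _, hl.replace_left (hl.mem_iff_mem_left hx hQ huL huQ) hl' hxw⟩
  · have hr : IsHamPathList G t a (M.reverse ++ x :: L.reverse) := by simpa using hl.reverse
    exact ⟨_, _, hr.replace_left
      (hr.mem_iff_mem_left hx hQ (List.mem_reverse.2 huM) huQ) hl' hxw⟩

theorem IsKK1Free.isClique_of_not_touches {H : Set V} {a b : V} (hG : IsKK1Free 4 G)
    (haH : a ∉ H) (ha : ¬ Touches G H a) (hbH : b ∉ H) (hb : ¬ Touches G H b) (hne : a ≠ b)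
    (hab : ¬ G.Adj a b) : G.IsClique H := by
  intro k hk k' hk' hkk
  by_contra hadj
  have hnot : ∀ {z j}, ¬ Touches G H z → j ∈ H → ¬ G.Adj j z := fun hz hj h =>
    hz ⟨_, hj, h.symm⟩
  have := hnot ha hk
  have := hnot ha hk'
  have := hnot hb hk
  have := hnot hb hk'
  have := hG.not_pairwise_not_adj (l := [k, k', a, b]) (by grind) rfl
  grind

theorem IsLongest.exists_eq_cons_append_cons {P : List V} {H : Set V} (hG : IsKK1Free 4 G)
    (hP : IsLongest G (·.head? = some u) P) (hH : IsComponentOfDel G {x | x ∈ P} H)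
    (hc : G.Preconnected) (hart : ∀ v, ¬ IsArticulationPoint G v) :
    ∃ A s B, P = u :: (A ++ s :: B) ∧ ∀ z ∈ P, Touches G H z ↔ z = u ∨ z = s := by
  have huP : u ∈ P := List.mem_of_head? hP.prop
  obtain ⟨t, ht⟩ : ∃ t, P.getLast? = some t :=
    ⟨_, List.getLast?_eq_some_getLast (List.ne_nil_of_mem huP)⟩
  have htP : t ∈ P := List.mem_of_getLast? ht
  obtain ⟨h, hh⟩ := hH.nonempty
  obtain ⟨z, hzP, -, hz⟩ := hH.isDelClosed.exists_touches (S := ∅)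
    (by simpa only [isVertexCut_empty_iff, not_not] using hc) hh (Set.disjoint_empty H)
    (fun huH => hH.isDelClosed.notMem huH huP) (Set.notMem_empty u)
  obtain ⟨z', hzP', hzz', hz'⟩ := hH.exists_touches_ne (hart z) hzP htP
    fun htz => hP.not_touches_getLast hH ht (htz ▸ hz)
  -- A longest path from `u` starts at the first of any two of its vertices that touch `H`.
  have hfirst : ∀ {U A B : List V} {x y}, P = U ++ x :: (A ++ y :: B) → Touches G H x →
      Touches G H y → U = [] ∧ x = u := by
    intro U A B x y hPe hx hy
    obtain rfl := hP.eq_nil_of_touches_of_touches hG hH hPe hx hy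
    exact ⟨rfl, by simpa [hPe] using hP.prop⟩
  obtain ⟨U, x, A, s, B, hPe, hu, hs⟩ :=
    exists_eq_append_cons_append_cons hzP hzP' hzz'.symm hz hz'
  obtain ⟨rfl, rfl⟩ := hfirst hPe hu hs
  refine ⟨A, s, B, hPe, fun w hwP => ⟨fun hw => ?_, by rintro (rfl | rfl) <;> assumption⟩⟩
  by_contra! ⟨hwx, hws⟩
  obtain ⟨U, y, A', y', B', hPe', hy, hy'⟩ := exists_eq_append_cons_append_cons
    (q := fun z => Touches G H z ∧ z ≠ x) (a := w) (b := s) hwP (by grind) hws ⟨hw, hwx⟩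
    ⟨hs, by have := hP.isPathList.nodup; grind⟩
  exact hy.2 (hfirst hPe' hy.1 hy'.1).2

theorem IsLongest.exists_clique_isDelClosed_pair {P : List V} {H : Set V} (hG : IsKK1Free 4 G)
    (hP : IsLongest G (·.head? = some u) P) (hH : IsComponentOfDel G {x | x ∈ P} H)
    (hc : G.Preconnected) (hart : ∀ v, ¬ IsArticulationPoint G v) :
    G.IsClique H ∧ ∃ s ≠ u, IsDelClosed G {u, s} H ∧ ∃ b, b ∉ ({u, s} : Set V) ∧ b ∉ H := by
  obtain ⟨A, s, B, hPe, htouch⟩ := hP.exists_eq_cons_append_cons hG hH hc hart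
  have hHP : ∀ {z}, z ∈ P → z ∉ H := fun hz hzH => hH.isDelClosed.notMem hzH hz
  obtain ⟨a, b, ha, hb, haH, hbH, hab⟩ := hP.exists_successors_of_head? (U := []) hH hPe
    ((htouch u (by grind)).2 (.inl rfl)) ((htouch s (by grind)).2 (.inr rfl))
  have haA := List.mem_of_head? ha
  have hbB := List.mem_of_head? hb
  have hnodup := hP.isPathList.nodup
  refine ⟨hG.isClique_of_not_touches (hHP (by grind)) haH (hHP (by grind)) hbH (by grind) hab,
    s, by grind, ⟨fun hv hvs => hHP (by grind) hv, fun {v w} hv hvw hw => ?_⟩, b, by grind,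
    hHP (by grind)⟩
  refine hH.isDelClosed.mem_of_adj hv hvw fun hwP => hw ?_
  exact (htouch w hwP).1 ⟨v, hv, hvw.symm⟩

theorem IsComponentOfDel.exists_adj_adj_of_pair {Q : Set V} {s : V}
    (hart : ∀ v, ¬ IsArticulationPoint G v) (hsu : s ≠ u) (hQ : IsComponentOfDel G {u, s} Q) :
    ∃ m ∈ Q, m ∈ {z | G.Adj u z} ∧ ∃ k ∈ Q, k ∈ {z | G.Adj s z} ∧ (m ≠ k ∨ Q = {k}) := by
  refine exists_distinct_representatives ?_ ?_ fun m hm hum hQm => ?_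
  · obtain ⟨z, hz, hzs, m, hm, hzm⟩ :=
      hQ.exists_touches_ne (hart s) (by simp) (Set.mem_insert u _) hsu.symm
    obtain rfl : z = u := hz.resolve_right hzs
    exact ⟨m, hm, hzm⟩
  · obtain ⟨z, hz, hzu, k, hk, hzk⟩ :=
      hQ.exists_touches_ne (hart u) (Set.mem_insert u _) (v := s) (by simp) hsu
    obtain rfl : z = s := hz.resolve_left hzu
    exact ⟨k, hk, hzk⟩
  · obtain ⟨x, hx, hxm⟩ := ((Set.nontrivial_iff_ne_singleton hm).2 hQm).exists_ne m
    have huQ : u ∉ Q := fun hu => hQ.isDelClosed.notMem hu (by simp)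
    obtain ⟨z, hz, hzm, k, ⟨hk, hkm⟩, hzk⟩ :=
      (hQ.isDelClosed.insert_diff_singleton hum).exists_touches (hart m) ⟨hx, hxm⟩
        Set.disjoint_sdiff_left (fun hu => huQ hu.1) (show u ≠ m from fun h => huQ (h ▸ hm))
    obtain rfl : z = s := hz.resolve_left hzm
    exact ⟨k, hk, hzk, hkm⟩

theorem exists_isHamPathList_of_isClique_component [Finite V] {Q₁ Q₂ : Set V} {s : V} {w v : Q₂}
    {l : List Q₂} (hart : ∀ v, ¬ IsArticulationPoint G v) (hsu : s ≠ u)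
    (hQ₁ : IsComponentOfDel G {u, s} Q₁) (hclique : G.IsClique Q₁)
    (hQ₂ : IsDelClosed G {u, s} Q₂) (hdisj : Disjoint Q₁ Q₂)
    (hcover : ∀ z ∉ ({u, s} : Set V), z ∈ Q₁ ∨ z ∈ Q₂) (hsw : G.Adj s w)
    (hl : IsHamPathList (G.induce Q₂) w v l) : ∃ l, IsHamPathList G u v l := by
  obtain ⟨m, hm, hum, k, hk, hsk, hmk⟩ := hQ₁.exists_adj_adj_of_pair hart hsu
  obtain ⟨M, hM, hMm, hMk, hMQ⟩ := exists_isPathList_of_isClique hclique hm hk hmk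
  have hlQ : ∀ z, z ∈ l.map Subtype.val ↔ z ∈ Q₂ := fun z => hl.mem_map_val
  have hQ₁A : ∀ z ∈ Q₁, z ≠ u ∧ z ≠ s := fun z hz => by simpa using hQ₁.isDelClosed.notMem hz
  have hQ₂A : ∀ z ∈ Q₂, z ≠ u ∧ z ≠ s := fun z hz => by simpa using hQ₂.notMem hz
  have hQ : ∀ z ∈ Q₁, z ∉ Q₂ := fun z hz hz₂ => Set.disjoint_left.1 hdisj hz hz₂
  have hsl : IsPathList G (s :: l.map Subtype.val) := by
    refine isPathList_cons.2 ⟨?_, by grind, hl.isPathList.map_val⟩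
    rw [List.head?_map, hl.head?]
    simpa using hsw
  refine ⟨u :: (M ++ s :: l.map Subtype.val), isPathList_cons.2 ⟨?_, by grind,
    isPathList_append.2 ⟨hM, hsl, ?_, fun z hz => by grind⟩⟩, rfl, ?_, fun z => ?_⟩
  · simpa [hMm] using hum
  · simpa [hMk] using G.adj_symm hsk
  · rw [← List.cons_append, List.getLast?_append, List.getLast?_cons, List.getLast?_map,
      hl.getLast?]
    rfl
  · have := hcover z
    grind

theorem CondF.exists_adj_not_isArticulationPoint [Finite V] {Q₁ Q₂ : Set V} {s : V}
    (hF : CondF G u) (h2 : IsTwoConnected G) (hsu : s ≠ u) (hcut : IsVertexCut G {u, s})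
    (hnum : ¬ 3 ≤ numComponents (del G {u, s})) (hQ₁ : IsComponentOfDel G {u, s} Q₁)
    (hQ₂ : IsComponentOfDel G {u, s} Q₂) (hne : Q₁ ≠ Q₂) (hclique : G.IsClique Q₁) :
    ∃ w : Q₂, G.Adj s w ∧ ¬ IsArticulationPoint (G.induce Q₂) w := by
  by_contra! hcon
  have hnum₂ := hcut.two_le_numComponents
  have hmin := h2.isMinVertexCut_pair hcut
  rw [Set.pair_comm] at hnum hnum₂ hmin hQ₁ hQ₂
  exact hF h2 s u hsu hmin (by omega) Q₁ Q₂ hQ₁ hQ₂ hne hclique hcon rfl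

theorem exists_isHamPathList_of_forall_not_isArticulationPoint [Finite V] (hG : IsKK1Free 4 G)
    (hc : G.Preconnected) (hart : ∀ v, ¬ IsArticulationPoint G v) (hE : CondE G u)
    (hF : CondF G u) : ∃ v l, IsHamPathList G u v l := by
  obtain ⟨P, hP⟩ := exists_isLongest (G := G) (p := (·.head? = some u)) (l := [u])
    ⟨.singleton u, List.nodup_singleton u⟩ rfl
  have huP : u ∈ P := List.mem_of_head? hP.prop
  by_cases hspan : ∀ h, h ∈ P
  · exact ⟨_, P, hP.isPathList, hP.prop,
      List.getLast?_eq_some_getLast (List.ne_nil_of_mem huP), hspan⟩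
  push Not at hspan
  obtain ⟨h, hhP⟩ := hspan
  obtain ⟨H, hH, hh⟩ := exists_isComponentOfDel (G := G) (A := {x | x ∈ P}) hhP
  obtain ⟨hclique, s, hsu, hHcl, b, hbA, hbH⟩ := hP.exists_clique_isDelClosed_pair hG hH hc hart
  have hcut : IsVertexCut G {u, s} := hHcl.isVertexCut hh hbH hbA
  have h2 := isTwoConnected_of_isVertexCut_pair hc hart hsu.symm hcut
  have hnum : ¬ 3 ≤ numComponents (del G {u, s}) := fun h3 => hE ⟨s, h3⟩
  have hhA := hHcl.notMem hh
  obtain ⟨Q₁, hQ₁, hhQ₁⟩ := exists_isComponentOfDel hhA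
  obtain ⟨Q₂, hQ₂, hbQ₂⟩ := exists_isComponentOfDel hbA
  have hQ₁H : Q₁ ⊆ H := hQ₁.subset hHcl hhQ₁ hh
  have hdisj : ∀ z ∈ Q₁, z ∉ Q₂ := fun z hz hz₂ =>
    hbH (hQ₁H (hQ₂.subset hQ₁.isDelClosed hz₂ hz hbQ₂))
  have hcover : ∀ z ∉ ({u, s} : Set V), z ∈ Q₁ ∨ z ∈ Q₂ := fun z =>
    hQ₁.isDelClosed.mem_or_mem_of_not_three_le hQ₂.isDelClosed hQ₁.nonempty hQ₂.nonempty
      (Set.disjoint_left.2 hdisj) hnum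
  have hclique₁ : G.IsClique Q₁ := hclique.subset hQ₁H
  obtain ⟨w, hsw, hw⟩ := hF.exists_adj_not_isArticulationPoint h2 hsu hcut hnum hQ₁ hQ₂
    (fun hQ => hdisj h hhQ₁ (hQ ▸ hhQ₁)) hclique₁
  have hhQ₂ : ¬ Touches G Q₂ h := fun ⟨k, hk, hhk⟩ =>
    hdisj h hhQ₁ (hQ₂.isDelClosed.mem_of_adj hk hhk.symm hhA)
  obtain ⟨v, l, hl⟩ := exists_isHamPathList_of_not_isArticulationPoint
    (hG.induce_of_not_touches (hdisj h hhQ₁) hhQ₂) hQ₂.preconnected hw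
  exact ⟨v, exists_isHamPathList_of_isClique_component hart hsu hQ₁ hclique₁ hQ₂.isDelClosed
    (Set.disjoint_left.2 hdisj) hcover hsw hl⟩

end Sufficiency

section Necessity

variable {Q : Set V} {u v x y : V} {l : List V}

theorem IsPathList.exists_isHamPathList_induce (h : IsPathList G l) (hne : l ≠ [])
    (hQ : ∀ z, z ∈ Q ↔ z ∈ l) : ∃ u v : Q, l.head? = some ↑u ∧ l.getLast? = some ↑v ∧
      ∃ l, IsHamPathList (G.induce Q) u v l := by
  have hval : (l.attachWith (· ∈ Q) fun z => (hQ z).2).map Subtype.val = l :=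
    List.attachWith_map_subtype_val _
  have hinj := Option.map_injective (Subtype.val_injective (p := (· ∈ Q)))
  have hhead := List.head?_eq_some_head hne
  have hlast := List.getLast?_eq_some_getLast hne
  refine ⟨⟨_, (hQ _).2 (List.head_mem hne)⟩, ⟨_, (hQ _).2 (List.getLast_mem hne)⟩, hhead, hlast,
    _, h.attachWith fun z => (hQ z).2, hinj ?_, hinj ?_, fun z => ?_⟩
  · rw [← List.head?_map, hval, hhead, Option.map_some]
  · rw [← List.getLast?_map, hval, hlast, Option.map_some]
  · rw [← List.mem_map_of_injective Subtype.val_injective, hval]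
    exact (hQ z).1 z.2

theorem IsHamPathList.ne [Nontrivial V] (h : IsHamPathList G u v l) : u ≠ v := by
  rintro rfl
  obtain ⟨l, rfl⟩ := h.exists_eq_cons
  obtain ⟨-, hul, -⟩ := isPathList_cons.1 h.isPathList
  obtain ⟨w, hw⟩ := exists_ne u
  have hwl : w ∈ l := (List.mem_cons.1 (h.mem w)).resolve_left hw
  have hlast := h.getLast?
  rw [List.getLast?_cons_of_ne_nil (List.ne_nil_of_mem hwl)] at hlast
  exact hul (List.mem_of_getLast? hlast)

theorem IsHamPathList.not_isVertexCut_pair (h : IsHamPathList G u v l) :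
    ¬ IsVertexCut G {u, v} := by
  obtain ⟨l, rfl⟩ := h.exists_eq_cons
  have hnodup := h.isPathList.nodup
  have hlast := h.getLast?
  obtain rfl | ⟨l, w, rfl⟩ := l.eq_nil_or_concat'
  · refine not_isVertexCut_of_isChain (l := []) .nil fun w => ?_
    have := h.mem w
    grind
  · obtain rfl : w = v := by simpa [List.getLast?_cons] using hlast
    refine not_isVertexCut_of_isChain h.isPathList.isChain.tail.left_of_append fun w => ?_
    have := h.mem w
    grind

theorem IsHamPathList.inDifferentComponents (h : IsHamPathList G u v l) (hyu : y ≠ u)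
    (hy : IsArticulationPoint G y) : InDifferentComponents G {y} u v := by
  have hyv : y ≠ v := fun hyv => h.reverse.not_isArticulationPoint (hyv ▸ hy)
  obtain ⟨L, M, rfl⟩ := List.append_of_mem (h.mem y)
  have huL := h.mem_left hyu
  have hvM : v ∈ M := by
    cases M with
    | nil => exact absurd (by simpa using h.getLast?) hyv
    | cons z M => exact List.mem_of_getLast? (by simpa [List.getLast?_cons] using h.getLast?)
  have hnodup := h.isPathList.nodup
  exact ((h.isDelClosed_right hyu hy).inDifferentComponents hvM
    (show u ∉ M by grind) hyu.symm).symm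

theorem IsHamPathList.exists_induce_component (h : IsHamPathList G u v l) (hxu : x ≠ u)
    (hx : IsArticulationPoint G x) (hQ : IsComponentOfDel G {x} Q) (huQ : u ∈ Q) :
    ∃ w : Q, G.Adj x w ∧ ∃ l, IsHamPathList (G.induce Q) ⟨u, huQ⟩ w l := by
  obtain ⟨L, M, rfl⟩ := List.append_of_mem (h.mem x)
  have huL := h.mem_left hxu
  have hL := List.ne_nil_of_mem huL
  have hmem := h.mem_iff_mem_left hx hQ huL huQ
  obtain ⟨hLpath, -, hadj, -⟩ := isPathList_append.1 h.isPathList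
  obtain ⟨u', w, hu', hw, hl⟩ := hLpath.exists_isHamPathList_induce hL hmem
  obtain rfl : u' = ⟨u, huQ⟩ := Subtype.ext <| Option.some_injective _ <| by
    rw [← hu', ← List.head?_append_of_ne_nil _ hL, h.head?]
  exact ⟨w, (hadj w hw x rfl).symm, hl⟩

theorem IsHamPathList.condC (h : IsHamPathList G u v l) : CondC G u := by
  intro x hxu hx Q hQ hu _ y hyu hy
  obtain ⟨w, hxw, l', hl'⟩ := h.exists_induce_component hxu hx hQ hu
  exact ⟨w, hxw, hl'.inDifferentComponents hyu hy⟩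

theorem IsHamPathList.condD [Finite V] (h : IsHamPathList G u v l) : CondD G u := by
  intro x hxu hx Q hQ hu h2
  obtain ⟨w, hxw, l', hl'⟩ := h.exists_induce_component hxu hx hQ hu
  have hcard := (isTwoConnected_iff.1 h2).2.1
  have : Nontrivial Q := Finite.one_lt_card_iff_nontrivial.1 (by omega)
  exact ⟨w, hxw, hl'.ne.symm, fun hmin => hl'.not_isVertexCut_pair hmin.1⟩

theorem IsHamPathList.condE [Finite V] (h : IsHamPathList G u v l) : CondE G u := by
  rintro ⟨x, hx⟩
  obtain ⟨l, rfl⟩ := h.exists_eq_cons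
  have hchain := h.isPathList.isChain.tail
  have hnodup := h.isPathList.nodup
  obtain rfl | hxl := List.mem_cons.1 (h.mem x)
  · refine not_three_le_numComponents_of_isChain hchain .nil (fun w => ?_) hx
    have := h.mem w
    grind
  · obtain ⟨A, B, rfl⟩ := List.append_of_mem hxl
    refine not_three_le_numComponents_of_isChain hchain.left_of_append
      hchain.right_of_append.tail (fun w => ?_) hx
    have := h.mem w
    grind

theorem IsHamPathList.exists_adj_not_isArticulationPoint (h : IsHamPathList G u v l) (hxu : x ≠ u)
    (hcut : IsVertexCut G {x, u}) (hQ : IsComponentOfDel G {x, u} Q) :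
    ∃ w : Q, G.Adj x w ∧ ¬ IsArticulationPoint (G.induce Q) w := by
  obtain ⟨l, rfl⟩ := h.exists_eq_cons
  obtain ⟨A, B, rfl⟩ := List.append_of_mem ((List.mem_cons.1 (h.mem x)).resolve_left hxu)
  obtain ⟨hA, hxB, hadjA, -⟩ := isPathList_append.1 (isPathList_cons.1 h.isPathList).2.2
  obtain ⟨hadjB, -, hB⟩ := isPathList_cons.1 hxB
  have hnodup := h.isPathList.nodup
  have hmem : ∀ z, z ∈ A ∨ z ∈ B ↔ z ∉ ({x, u} : Set V) := fun z => by
    have := h.mem z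
    grind
  obtain ⟨q, hq⟩ := hQ.nonempty
  obtain hqA | hqB := (hmem q).2 (hQ.isDelClosed.notMem hq)
  · have hQA := hQ.mem_iff_mem_chain hcut hA.isChain hB.isChain hmem hqA hq
    obtain ⟨v, w, -, hw, l, hl⟩ := hA.exists_isHamPathList_induce (List.ne_nil_of_mem hqA) hQA
    exact ⟨w, (hadjA w hw x rfl).symm, hl.reverse.not_isArticulationPoint⟩
  · have hQB := hQ.mem_iff_mem_chain hcut hB.isChain hA.isChain
      (fun z => or_comm.trans (hmem z)) hqB hq
    obtain ⟨w, v, hw, -, l, hl⟩ := hB.exists_isHamPathList_induce (List.ne_nil_of_mem hqB) hQB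
    exact ⟨w, hadjB w hw, hl.not_isArticulationPoint⟩

theorem IsHamPathList.condF (h : IsHamPathList G u v l) : CondF G u := by
  rintro - x y hxy hmin - Q₁ Q₂ - hQ₂ - - hart rfl
  obtain ⟨w, hxw, hw⟩ := h.exists_adj_not_isArticulationPoint hxy hmin.1 hQ₂
  exact hw (hart w hxw)

end Necessity

end HamPath

theorem theorem5 {V : Type*} [Fintype V] [DecidableEq V] (G : SimpleGraph V)
    (hconn : G.Connected) (hfree : HamPath.IsKK1Free 4 G) (u : V) :
    HamPath.HasHamPathFrom G u ↔
      HamPath.HasHamPath G ∧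
      ¬ HamPath.IsArticulationPoint G u ∧
      HamPath.CondC G u ∧
      HamPath.CondD G u ∧
      HamPath.CondE G u ∧
      HamPath.CondF G u := by
  open HamPath in
  constructor
  · intro h
    obtain ⟨v, l, hl⟩ := hasHamPathFrom_iff.1 h
    exact ⟨⟨u, h⟩, hl.not_isArticulationPoint, hl.condC, hl.condD, hl.condE, hl.condF⟩
  · rintro ⟨⟨w, hw⟩, hu, hC, hD, hE, hF⟩
    rw [hasHamPathFrom_iff]
    by_cases hart : ∃ x, IsArticulationPoint G x
    · obtain ⟨x, hx⟩ := hart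
      obtain ⟨t, l, hl⟩ := hasHamPathFrom_iff.1 hw
      exact exists_isHamPathList_of_isArticulationPoint hfree hconn.preconnected hu hC hD hE hx hl
    · push Not at hart
      exact exists_isHamPathList_of_forall_not_isArticulationPoint hfree hconn.preconnected hart
        hE hF
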